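/- **Setting.** Let $G=(V,E)$ be an undirected graph with $n\ge 3$ vertices and positive real edge weights $w$; $|P|$ is the length of a path $P$, and $\delta_F(a,b)$ is the distance of $a,b$ in a subgraph $F$ ($+\infty$ if they are not connected). For $A\subseteq V$ and $a,b\in V\setminus A$ let $\pi_{G-A}(a,b)$ be a shortest $a$–$b$ path in $G-A$, fixed once for all $A,a,b$ (any choice is allowed). Let $d\ge 2$ be an integer, $c\ge 1$, $\epsilon>0$, $k=\ln n$, $s=4e\,d^{c+1}\ln^2 n+1$, $\epsilon_1=\epsilon/(2+\epsilon)$, $\epsilon_2=\epsilon_1/(2k-1)$. *Tree covers.* An $S$-restricted tree cover of a graph $F$ consists of one subtree $T(r)$ of $F$ rooted at $r$ for every $r\in S$, such that (i) for all $u\in S$ and $v\in V(F)$ connected to $u$ in $F$, some $T(r)$ contains both and the weighted depths satisfy $\mathrm{dep}_{T(r)}(u)+\mathrm{dep}_{T(r)}(v)\le(2k-1)\,\delta_F(u,v)$; (ii) every vertex is in at most $kn^{1/k}(\ln n+1)$ of the trees. For all $R,S\subseteq V$ let $\mathcal T_R(S)$ be any fixed $(S\setminus R)$-restricted tree cover of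 $G-R$, and $\mathcal T(S)=\mathcal T_\varnothing(S)$. For a tree $T$ of an $S$-restricted cover, $\mathrm{Trunk}(T)$ is the set of vertices on tree paths between two vertices of $S$; the pseudo-degree of a vertex $v$ in $T$ is its degree in the subtree induced by $\mathrm{Trunk}(T)$, and $0$ if $v\notin\mathrm{Trunk}(T)$. $\mathrm{Hi}$ of a cover is the set of vertices whose pseudo-degree exceeds $s$ in some tree of it. *Hierarchy tree.* Its root is $V$. A node $U$ is a leaf if $\mathrm{Hi}(\mathcal T(U))=\varnothing$; otherwise its children are $W_1,\dots,W_d$, where $W_0=\varnothing$ and $W_{i+1}=W_i\cup\mathrm{Hi}(\mathcal T_{W_i}(U))$. *Query.* Let $D\subseteq V$ with $|D|\le d$ and $u_0,v_0\in V\setminus D$. Start with $U_1=V$ and repeat, for at most $\lfloor\frac1c\log_d n\rfloor$ rounds: if $U_i$ is a leaf, stop; otherwise let $j\in[0,d]$ be least with $D\cap(W_{j+1}\setminus W_j)=\varnothing$ (with $W_{d+1}=W_d$ for the children of $U_i$); if $j=0$, stop; else $U_{i+1}=W_j$. Let $U_1,\dots,U_p$ be the resulting sequence, $U_{p+1}=\varnothing$,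 and let the level $l(x)$ be the largest $i$ with $x\in U_i$. *Decision trees.* Two inner vertices $a,b$ of a path $P$ from $x$ to $y$ are in the same segment if $|P[x,a]|,|P[x,b]|\le|P|/2$ and $\lfloor\log_{1+\epsilon_2}|P[x,a]|\rfloor=\lfloor\log_{1+\epsilon_2}|P[x,b]|\rfloor$, or $|P[a,y]|,|P[b,y]|<|P|/2$ and $\lfloor\log_{1+\epsilon_2}|P[a,y]|\rfloor=\lfloor\log_{1+\epsilon_2}|P[b,y]|\rfloor$; $\mathrm{seg}(a,P)$ is the segment of $a$. The decision tree $FT(x,y)$ has depth $d$. Each node $\alpha$ carries a set $\mathrm{avoid}(\alpha)$, empty at the root, and the path $P_\alpha=\pi_{G-\mathrm{avoid}(\alpha)}(x,y)$ (no vertices and length $+\infty$ if there is none). A node $\alpha$ of depth less than $d$ has a child $ch(\alpha,X,i)$ for every segment $X$ of $P_\alpha$ and $1\le i\le p$, with $\mathrm{avoid}(ch(\alpha,X,i))=\mathrm{avoid}(\alpha)\cup(X\cap U_i)$. The procedure $\mathrm{DecTree}(x,y,D)$ starts at the root $\alpha$ of $FT(x,y)$; while $D\cap P_\alpha\ne\varnothing$,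 it picks $f\in D\cap P_\alpha$ of highest level (ties broken arbitrarily) and replaces $\alpha$ by $ch(\alpha,\mathrm{seg}(f,P_\alpha),l(f))$; then it returns $|P_\alpha|$. *Auxiliary graph.* For $f\in D$ let $N(f)$ be the set of all vertices that, in some tree $T\in\bigcup_{i=1}^p\mathcal T_{U_{i+1}}(U_i)$ containing $f$, are the parent of $f$ or are a child of $f$ lying in $\mathrm{Trunk}(T)$ (the trunk is taken with respect to $U_i\setminus U_{i+1}$ for $T\in\mathcal T_{U_{i+1}}(U_i)$). $H$ is the complete graph on $V(H)=\bigl(\{u_0,v_0\}\cup\bigcup_{f\in D}N(f)\bigr)\setminus D$ in which going from $x$ to $y$ costs $\mathrm{DecTree}(x,y,D)$. For $u,v\in V(H)$ let $|\pi_H(u,v)|$ be the length of a shortest path from $u$ to $v$ in $H$; the oracle's answer to the query is $|\pi_H(u_0,v_0)|$. **Theorem.** For all choices above, $\mathrm{DecTree}(x,y,D)$ returns a value for all $x,y\in V(H)$ (it never has to descend below depth $d$), and for every pair $u,v\in V(H)$ $$\delta_{G-D}(u,v)\ \le\ |\pi_H(u,v)|\ \le\ (1+\epsilon)\,\delta_{G-D}(u,v).$$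 -/

import Mathlib

open scoped NNReal ENNReal

namespace VSDO

variable {V : Type*}

/-! ### Weighted graphs, lengths and distances

The input is a finite undirected graph `G` on the vertex type `V` whose edges carry the
weights `w : Sym2 V → ℝ≥0`. -/

/-- `G - R`, kept on the vertex type `V`: the vertices of `R` become isolated. -/
def delVerts (G : SimpleGraph V) (R : Set V) : SimpleGraph V where
  Adj a b := G.Adj a b ∧ a ∉ R ∧ b ∉ R
  symm := ⟨fun _ _ h => ⟨h.1.symm, h.2.2, h.2.1⟩⟩
  loopless := ⟨fun _ h => G.loopless.irrefl _ h.1⟩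

/-- The length `|P|` of a walk. -/
def len {G : SimpleGraph V} (w : Sym2 V → ℝ≥0) {a b : V} (P : G.Walk a b) : ℝ≥0 :=
  (P.edges.map w).sum

/-- The distance `δ_G(a, b)`; it is `⊤` if `a` and `b` are not connected. -/
noncomputable def gdist (G : SimpleGraph V) (w : Sym2 V → ℝ≥0) (a b : V) : ℝ≥0∞ :=
  ⨅ P : G.Walk a b, (len w P : ℝ≥0∞)

/-- `P` is a shortest path between its end points. -/
def IsShortestPath {G : SimpleGraph V} (w : Sym2 V → ℝ≥0) {a b : V} (P : G.Walk a b) : Prop :=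
  P.IsPath ∧ ∀ Q : G.Walk a b, len w P ≤ len w Q

/-! ### Source-restricted tree covers -/

/-- A rooted tree that is a subgraph of `G`. -/
structure RootedTree (G : SimpleGraph V) where
  tree : G.Subgraph
  isTree : tree.coe.IsTree
  root : V
  root_mem : root ∈ tree.verts

namespace RootedTree

variable {G : SimpleGraph V}

/-- The depth of `x` in `T`: its weighted distance in `T` from the root. -/
noncomputable def depth (T : RootedTree G) (w : Sym2 V → ℝ≥0) (x : V) : ℝ≥0∞ :=
  gdist T.tree.spanningCoe w T.root x

/-- `q` is the parent of `x` in `T`: it is the second vertex on the tree path from `x` to the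
root. -/
def IsParent (T : RootedTree G) (q x : V) : Prop :=
  ∃ (h : T.tree.spanningCoe.Adj x q) (P : T.tree.spanningCoe.Walk q T.root),
    (SimpleGraph.Walk.cons h P).IsPath

/-- The trunk vertices of `T` with respect to the source set `S`: those that lie on the tree
path between two vertices of `S`. -/
def trunk (T : RootedTree G) (S : Set V) : Set V :=
  {x | ∃ a ∈ S, ∃ b ∈ S, a ∈ T.tree.verts ∧ b ∈ T.tree.verts ∧
    ∃ P : T.tree.spanningCoe.Walk a b, P.IsPath ∧ x ∈ P.support}

/-- The pseudo-degree of `x`: its degree in the trunk, and `0` if `x` is not a trunk vertex. -/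
noncomputable def pdeg (T : RootedTree G) (S : Set V) (x : V) : ℕ :=
  {y | x ∈ T.trunk S ∧ y ∈ T.trunk S ∧ T.tree.Adj x y}.ncard

/-- `N_T(f)`: the parent of `f`, and those children of `f` that are trunk vertices. -/
def nbrs (T : RootedTree G) (S : Set V) (f : V) : Set V :=
  {y | T.IsParent y f ∨ (T.IsParent f y ∧ y ∈ T.trunk S)}

end RootedTree

/-- The parameter `k = ln n`, where `n` is the number of vertices of the input graph. -/
noncomputable def kParam (V : Type*) [Fintype V] : ℝ :=
  Real.log (Fintype.card V)

/-- An `S`-restricted tree cover of the graph `G`. -/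
structure TreeCover [Fintype V] (G : SimpleGraph V) (w : Sym2 V → ℝ≥0) (S : Set V) where
  /-- The trees `T(s)`, one for each `s ∈ S`. -/
  T : S → RootedTree G
  root_eq : ∀ s, (T s).root = s
  /-- If `u ∈ S` and `v` are connected, some tree contains both and the sum of their depths in
  it is at most `(2k - 1) δ(u, v)`. -/
  stretch : ∀ u ∈ S, ∀ v, G.Reachable u v → ∃ s,
    u ∈ (T s).tree.verts ∧ v ∈ (T s).tree.verts ∧
      (T s).depth w u + (T s).depth w v ≤ ENNReal.ofReal (2 * kParam V - 1) * gdist G w u v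
  /-- Every vertex is in at most `k n^{1/k} (ln n + 1)` trees. -/
  overlap : ∀ v, ({s | v ∈ (T s).tree.verts}.ncard : ℝ) ≤
    kParam V * (Fintype.card V : ℝ) ^ (1 / kParam V) * (Real.log (Fintype.card V) + 1)

/-- The choices that the construction of the oracle makes on the graph `G`. -/
structure Choices [Fintype V] (G : SimpleGraph V) (w : Sym2 V → ℝ≥0) where
  /-- `cover R S` is `𝒯_R(S)`, an `(S \ R)`-restricted tree cover of `G - R`;
  `𝒯(S)` is `cover ∅ S`. -/
  cover : ∀ R S : Set V, TreeCover (delVerts G R) w (S \ R)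
  /-- `path A x y` is `π_{G-A}(x, y)`, a shortest path in `G - A`, and `none` if there is none. -/
  path : ∀ (A : Set V) (x y : V), Option ((delVerts G A).Walk x y)
  path_none : ∀ A x y, path A x y = none ↔ ¬ (delVerts G A).Reachable x y
  path_shortest : ∀ A x y, ∀ P ∈ path A x y, IsShortestPath w P

/-! ### The high-degree hierarchy -/

/-- The degree threshold `s = 4 e d^{c+1} ln² n + 1`. -/
noncomputable def threshold (V : Type*) [Fintype V] (d : ℕ) (c : ℝ) : ℝ :=
  4 * Real.exp 1 * (d : ℝ) ^ (c + 1) * Real.log (Fintype.card V) ^ 2 + 1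

/-- `Hi` of a tree cover: the vertices of pseudo-degree larger than `t` in some tree. -/
def TreeCover.hi [Fintype V] {G : SimpleGraph V} {w : Sym2 V → ℝ≥0} {S : Set V}
    (C : TreeCover G w S) (t : ℝ) : Set V :=
  {x | ∃ s, t < ((C.T s).pdeg S x : ℝ)}

namespace Choices

variable [Fintype V] {G : SimpleGraph V} {w : Sym2 V → ℝ≥0}

/-- The children of the node `U` of the hierarchy tree are `W_1, …, W_d`, where `W_0 = ∅` and
`W_{i+1} = W_i ∪ Hi(𝒯_{W_i}(U))`; so `W_1 = Hi(𝒯(U))`. -/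
noncomputable def child (O : Choices G w) (d : ℕ) (c : ℝ) (U : Set V) : ℕ → Set V
  | 0 => ∅
  | i + 1 => child O d c U i ∪ (O.cover (child O d c U i) U).hi (threshold V d c)

/-- The least `j ∈ [0, d]` with `D ∩ (W_{j+1} \ W_j) = ∅`, where `W_{d+1} = W_d`. -/
noncomputable def nextIndex (O : Choices G w) (d : ℕ) (c : ℝ) (D U : Set V) : ℕ :=
  sInf {j | j ≤ d ∧ D ∩ (O.child d c U (min (j + 1) d) \ O.child d c U j) = ∅}

open Classical in
/-- At most `m` rounds of the path finding algorithm for `D`, started at the node `U`. A node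
`U` is a leaf of the hierarchy tree if `Hi(𝒯(U)) = W_1` is empty. -/
noncomputable def pathFrom (O : Choices G w) (d : ℕ) (c : ℝ) (D : Set V) :
    ℕ → Set V → List (Set V)
  | 0, U => [U]
  | m + 1, U =>
    if O.child d c U 1 = ∅ then [U]
    else if O.nextIndex d c D U = 0 then [U]
    else U :: pathFrom O d c D m (O.child d c U (O.nextIndex d c D U))

/-- The path `U_1, …, U_p` of the hierarchy tree that the path finding algorithm returns for
`D`. It makes at most `⌊(1/c) log_d n⌋` rounds and starts at the root `U_1 = V`. -/
noncomputable def hpath (O : Choices G w) (d : ℕ) (c : ℝ) (D : Set V) : List (Set V) :=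
  O.pathFrom d c D ⌊1 / c * Real.logb d (Fintype.card V)⌋₊ Set.univ

/-- The set `U_i` for `1 ≤ i ≤ p`; the other `U_i`, in particular `U_{p+1}`, are empty. -/
noncomputable def U (O : Choices G w) (d : ℕ) (c : ℝ) (D : Set V) (i : ℕ) : Set V :=
  (∅ :: O.hpath d c D).getD i ∅

/-- The level of `x`: the largest `i` such that `x ∈ U_i`. -/
noncomputable def level (O : Choices G w) (d : ℕ) (c : ℝ) (D : Set V) (x : V) : ℕ :=
  sSup {i | x ∈ O.U d c D i}

end Choices

/-! ### Segments of a path -/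

section Segments

variable [DecidableEq V] {G : SimpleGraph V}

/-- `|P[x, t]|` for a vertex `t` of a path `P` from `x` to `y`. -/
noncomputable def lenTo (w : Sym2 V → ℝ≥0) {x y : V} (P : G.Walk x y) (t : V) : ℝ :=
  if h : t ∈ P.support then len w (P.takeUntil t h) else 0

/-- `|P[t, y]|` for a vertex `t` of a path `P` from `x` to `y`. -/
noncomputable def lenFrom (w : Sym2 V → ℝ≥0) {x y : V} (P : G.Walk x y) (t : V) : ℝ :=
  if h : t ∈ P.support then len w (P.dropUntil t h) else 0

/-- Two inner vertices of `P` are in the same `e`-segment of `P`. -/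
def SameSegment (w : Sym2 V → ℝ≥0) (e : ℝ) {x y : V} (P : G.Walk x y) (s t : V) : Prop :=
  (lenTo w P s ≤ len w P / 2 ∧ lenTo w P t ≤ len w P / 2 ∧
    ⌊Real.logb (1 + e) (lenTo w P s)⌋ = ⌊Real.logb (1 + e) (lenTo w P t)⌋) ∨
  (lenFrom w P s < len w P / 2 ∧ lenFrom w P t < len w P / 2 ∧
    ⌊Real.logb (1 + e) (lenFrom w P s)⌋ = ⌊Real.logb (1 + e) (lenFrom w P t)⌋)

/-- The vertices of `seg(f, P)`, for an inner vertex `f` of `P`. -/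
def seg (w : Sym2 V → ℝ≥0) (e : ℝ) {x y : V} (f : V) (P : G.Walk x y) : Set V :=
  {t | t ∈ P.support ∧ t ≠ x ∧ t ≠ y ∧ SameSegment w e P f t}

end Segments

/-- `ε₁ = ε / (2 + ε)` and `ε₂ = ε₁ / (2k - 1)`. -/
noncomputable def eps2 (V : Type*) [Fintype V] (ε : ℝ) : ℝ :=
  ε / (2 + ε) / (2 * kParam V - 1)

/-! ### Decision trees -/

/-- A node of a decision tree `FT(x, y)` is described by the sequence of pairs `(X, i)` that
leads to it from the root, the last pair first: `ch(α, X, i)` is `(X, i) :: α`. -/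
abbrev Node (V : Type*) := List (Set V × ℕ)

namespace Choices

variable [Fintype V] {G : SimpleGraph V} {w : Sym2 V → ℝ≥0}

/-- `avoid(α)`. -/
noncomputable def avoid (O : Choices G w) (d : ℕ) (c : ℝ) (D : Set V) : Node V → Set V
  | [] => ∅
  | (X, i) :: α => avoid O d c D α ∪ (X ∩ O.U d c D i)

/-- The failed vertices on the path `P_α` stored at the node `α` of `FT(x, y)`. -/
noncomputable def hit (O : Choices G w) (d : ℕ) (c : ℝ) (D : Set V) (x y : V) (α : Node V) :
    Set V :=
  match O.path (O.avoid d c D α) x y with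
  | none => ∅
  | some P => {f | f ∈ D ∧ f ∈ P.support}

/-- The length `|P_α|`, which is `⊤` if `x` and `y` are not connected in `G - avoid(α)`. -/
noncomputable def storedLen (O : Choices G w) (d : ℕ) (c : ℝ) (D : Set V) (x y : V)
    (α : Node V) : ℝ≥0∞ :=
  match O.path (O.avoid d c D α) x y with
  | none => ⊤
  | some P => len w P

/-- The child `ch(α, seg(f, P_α), l(f))` of the node `α` of `FT(x, y)`. -/
noncomputable def descend [DecidableEq V] (O : Choices G w) (d : ℕ) (c ε : ℝ) (D : Set V)
    (x y : V) (α : Node V) (f : V) : Node V :=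
  match O.path (O.avoid d c D α) x y with
  | none => α
  | some P => (seg w (eps2 V ε) f P, O.level d c D f) :: α

/-- `pick x y α` is the failed vertex that `DecTree(x, y, D)` selects at the node `α`: a vertex
of `D ∩ P_α` of highest level, ties being broken arbitrarily. -/
def IsPick (O : Choices G w) (d : ℕ) (c : ℝ) (D : Set V) (pick : V → V → Node V → V) : Prop :=
  ∀ x y α, (O.hit d c D x y α).Nonempty →
    pick x y α ∈ O.hit d c D x y α ∧
      ∀ g ∈ O.hit d c D x y α, O.level d c D g ≤ O.level d c D (pick x y α)

open Classical in
/-- The loop of `DecTree`, at a node `α` below which the decision tree has `m` more layers. The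
result is `none` if the loop would have to descend from a node of the last layer. -/
noncomputable def decTreeLoop [DecidableEq V] (O : Choices G w) (d : ℕ) (c ε : ℝ) (D : Set V)
    (pick : V → V → Node V → V) (x y : V) : ℕ → Node V → Option ℝ≥0∞
  | 0, α => if O.hit d c D x y α = ∅ then some (O.storedLen d c D x y α) else none
  | m + 1, α =>
    if O.hit d c D x y α = ∅ then some (O.storedLen d c D x y α)
    else decTreeLoop O d c ε D pick x y m (O.descend d c ε D x y α (pick x y α))

/-- `DecTree(x, y, D)`: the decision tree has depth `d`, and the loop starts at its root. -/
noncomputable def decTree [DecidableEq V] (O : Choices G w) (d : ℕ) (c ε : ℝ) (D : Set V)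
    (pick : V → V → Node V → V) (x y : V) : Option ℝ≥0∞ :=
  O.decTreeLoop d c ε D pick x y d []

/-! ### The auxiliary graph -/

/-- `N(f)`: the union of `N_T(f)` over all trees `T` that contain `f` and belong to one of the
covers `𝒯_{U_{i+1}}(U_i)`, `1 ≤ i ≤ p`. -/
def N (O : Choices G w) (d : ℕ) (c : ℝ) (D : Set V) (f : V) : Set V :=
  {y | ∃ i, 1 ≤ i ∧ i ≤ (O.hpath d c D).length ∧
    ∃ s, f ∈ ((O.cover (O.U d c D (i + 1)) (O.U d c D i)).T s).tree.verts ∧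
      y ∈ ((O.cover (O.U d c D (i + 1)) (O.U d c D i)).T s).nbrs
        (O.U d c D i \ O.U d c D (i + 1)) f}

/-- The vertex set `V(H)` of the auxiliary graph for the query `(u, v, D)`. -/
def VH (O : Choices G w) (d : ℕ) (c : ℝ) (D : Set V) (u v : V) : Set V :=
  ({u, v} ∪ ⋃ f ∈ D, O.N d c D f) \ D

end Choices

/-- The distance from `a` to `b` in the complete graph on the vertex set `A` in which going from
`x` to `y` costs `wt x y`. -/
noncomputable def auxDist (A : Set V) (wt : V → V → ℝ≥0∞) (a b : A) : ℝ≥0∞ :=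
  ⨅ P : (⊤ : SimpleGraph A).Walk a b, (P.darts.map fun e => wt e.fst e.snd).sum


/-! ### Tree covers exist

What follows proves that every input graph with at least three vertices has tree covers
in the above sense, so that there is an element of `Choices G w`. -/

section Dist
variable {G : SimpleGraph V} {w : Sym2 V → ℝ≥0}

lemma gdist_self (a : V) : gdist G w a a = 0 := by
  refine le_antisymm ((iInf_le _ (SimpleGraph.Walk.nil)).trans ?_) zero_le
  simp [len]

lemma gdist_comm (a b : V) : gdist G w a b = gdist G w b a := by
  have key : ∀ a b : V, gdist G w a b ≤ gdist G w b a := by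
    intro a b
    refine le_iInf fun P => (iInf_le _ P.reverse).trans ?_
    simp [len]
  exact le_antisymm (key a b) (key b a)

lemma gdist_triangle (a b c : V) : gdist G w a c ≤ gdist G w a b + gdist G w b c := by
  unfold gdist
  rw [ENNReal.iInf_add]
  refine le_iInf fun P => ?_
  rw [ENNReal.add_iInf]
  refine le_iInf fun Q => (iInf_le _ (P.append Q)).trans ?_
  simp [len]

lemma gdist_adj {a b : V} (h : G.Adj a b) : gdist G w a b ≤ w s(a, b) := by
  refine (iInf_le _ (SimpleGraph.Walk.cons h .nil)).trans ?_
  simp [len]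

lemma gdist_lt_top {a b : V} : gdist G w a b < ⊤ ↔ G.Reachable a b := by
  constructor
  · intro h
    obtain ⟨P, -⟩ := iInf_lt_iff.1 h
    exact ⟨P⟩
  · rintro ⟨P⟩
    exact (iInf_le _ P).trans_lt ENNReal.coe_lt_top

lemma exists_shortest [Finite V] {a b : V} (h : G.Reachable a b) :
    ∃ P : G.Walk a b, IsShortestPath w P := by
  classical
  have := Fintype.ofFinite V
  obtain ⟨Q⟩ := h
  have : Nonempty (G.Path a b) := ⟨Q.toPath⟩
  obtain ⟨P, hP⟩ := Finite.exists_min (fun P : G.Path a b => len w P.1)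
  refine ⟨P.1, P.2, fun Q => (hP Q.toPath).trans ?_⟩
  exact List.Sublist.sum_le_sum ((Q.edges_bypass_sublist_edges).map w) (by simp)

lemma IsShortestPath.gdist_eq {a b : V} {P : G.Walk a b} (hP : IsShortestPath w P) :
    gdist G w a b = len w P :=
  le_antisymm (iInf_le _ P) (le_iInf fun Q => by exact_mod_cast hP.2 Q)

lemma exists_next [Finite V] {a b : V} (h : G.Reachable a b) (hab : a ≠ b) :
    ∃ c, G.Adj a c ∧ gdist G w a b = w s(a, c) + gdist G w c b := by
  obtain ⟨P, hP⟩ := exists_shortest (w := w) h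
  have hd := hP.gdist_eq
  cases P with
  | nil => exact absurd rfl hab
  | cons hac Q =>
    rename_i c
    refine ⟨c, hac, le_antisymm ?_ ?_⟩
    · exact (gdist_triangle a c b).trans (by gcongr; exact gdist_adj hac)
    · rw [hd]
      have : gdist G w c b ≤ len w Q := iInf_le _ Q
      simpa [len] using (add_le_add_right this (w s(a, c) : ℝ≥0∞))

/-- A shortest path tree on a set `C`, given by parent pointers. -/
lemma exists_tree [Finite V] (hw : ∀ e ∈ G.edgeSet, 0 < w e) (r : V) (C : Set V) (hr : r ∈ C)
    (par : V → V)
    (hpar : ∀ x ∈ C, x ≠ r → par x ∈ C ∧ G.Adj x (par x) ∧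
      gdist G w x r = w s(x, par x) + gdist G w (par x) r)
    (hreach : ∀ x ∈ C, gdist G w x r < ⊤) :
    ∃ T : RootedTree G, T.root = r ∧ T.tree.verts = C ∧
      ∀ x ∈ C, T.depth w x ≤ gdist G w r x := by
  classical
  let S : G.Subgraph :=
    { verts := C
      Adj a b := (a ∈ C ∧ a ≠ r ∧ b = par a) ∨ (b ∈ C ∧ b ≠ r ∧ a = par b)
      adj_sub := by
        rintro a b (⟨h1, h2, rfl⟩ | ⟨h1, h2, rfl⟩)
        · exact (hpar _ h1 h2).2.1
        · exact (hpar _ h1 h2).2.1.symm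
      edge_vert := by
        rintro a b (⟨h1, h2, rfl⟩ | ⟨h1, h2, rfl⟩)
        · exact h1
        · exact (hpar _ h1 h2).1
      symm := ⟨by rintro a b (h | h); exacts [Or.inr h, Or.inl h]⟩ }
  have hlt : ∀ x ∈ C, x ≠ r → gdist G w (par x) r < gdist G w x r := by
    intro x hx hxr
    obtain ⟨h1, h2, h3⟩ := hpar x hx hxr
    rw [h3, add_comm]
    refine ENNReal.lt_add_right (hreach _ h1).ne ?_
    have := hw _ (G.mem_edgeSet.2 h2)
    exact_mod_cast this.ne'
  have wf : WellFounded (InvImage (· < ·) fun x : V => gdist G w x r) :=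
    Finite.wellFounded_of_trans_of_irrefl _
  have hconn : ∀ x, (hx : x ∈ C) → S.coe.Reachable ⟨x, hx⟩ ⟨r, hr⟩ := by
    intro x
    induction x using wf.induction with
    | _ x ih =>
      intro hx
      by_cases hxr : x = r
      · subst hxr; exact .rfl
      · have h1 := (hpar x hx hxr).1
        have : S.coe.Adj ⟨x, hx⟩ ⟨par x, h1⟩ := Or.inl ⟨hx, hxr, rfl⟩
        exact this.reachable.trans (ih (par x) (hlt x hx hxr) h1)
  have hC : S.coe.Connected := by
    have : Nonempty S.verts := ⟨⟨r, hr⟩⟩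
    exact ⟨fun a b => (hconn a.1 a.2).trans (hconn b.1 b.2).symm⟩
  have hdep : ∀ x ∈ C, gdist S.spanningCoe w x r ≤ gdist G w x r := by
    intro x
    induction x using wf.induction with
    | _ x ih =>
      intro hx
      by_cases hxr : x = r
      · subst hxr; simp [gdist_self]
      · obtain ⟨h1, h2, h3⟩ := hpar x hx hxr
        have hadj : S.spanningCoe.Adj x (par x) := Or.inl ⟨hx, hxr, rfl⟩
        rw [h3]
        exact (gdist_triangle x (par x) r).trans
          (add_le_add (gdist_adj hadj) (ih _ (hlt x hx hxr) h1))
  refine ⟨⟨S, ?_, r, hr⟩, rfl, rfl, fun x hx => ?_⟩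
  · rw [SimpleGraph.isTree_iff_connected_and_card]
    refine ⟨hC, le_antisymm ?_ hC.card_vert_le_card_edgeSet_add_one⟩
    let f : {x : S.verts // x ≠ ⟨r, hr⟩} → Sym2 S.verts := fun x =>
      s(x.1, ⟨par x.1.1, (hpar x.1.1 x.1.2 (fun h => x.2 (Subtype.ext h))).1⟩)
    have hsub : S.coe.edgeSet ⊆ Set.range f := by
      intro e
      induction e with
      | _ a b =>
        rintro (⟨h1, h2, h3⟩ | ⟨h1, h2, h3⟩)
        · refine ⟨⟨a, fun h => h2 (congrArg Subtype.val h)⟩, ?_⟩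
          have e1 : (⟨par a.1, (hpar a.1 a.2 h2).1⟩ : S.verts) = b := Subtype.ext h3.symm
          simp only [f]
          rw [e1]
        · refine ⟨⟨b, fun h => h2 (congrArg Subtype.val h)⟩, ?_⟩
          have e1 : (⟨par b.1, (hpar b.1 b.2 h2).1⟩ : S.verts) = a := Subtype.ext h3.symm
          simp only [f]
          rw [e1, Sym2.eq_swap]
    have h1 : Nat.card S.coe.edgeSet ≤ Nat.card {x : S.verts // x ≠ ⟨r, hr⟩} :=
      (Nat.card_mono (Set.toFinite _) hsub).trans (Finite.card_range_le f)
    have h2 : Nat.card {x : S.verts // x ≠ ⟨r, hr⟩} < Nat.card S.verts :=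
      Finite.card_subtype_lt (x := ⟨r, hr⟩) (by simp)
    omega
  · rw [RootedTree.depth, gdist_comm, gdist_comm r x]
    exact hdep x hx
end Dist
section Cover

lemma exists_lowest {β : Type*} [LinearOrder β] (A : Finset V) (f : V → β) (b : ℕ)
    (hb : b ≤ A.card) : ∃ N ⊆ A, N.card = b ∧ ∀ x ∈ N, ∀ y ∈ A, y ∉ N → f x ≤ f y := by
  classical
  induction b with
  | zero => exact ⟨∅, by simp⟩
  | succ b ih =>
    obtain ⟨N, hN, hc, hlow⟩ := ih (by omega)
    have hne : (A \ N).Nonempty := by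
      rw [← Finset.card_pos, Finset.card_sdiff_of_subset hN]; omega
    obtain ⟨z, hz, hmin⟩ := Finset.exists_min_image (A \ N) f hne
    rw [Finset.mem_sdiff] at hz
    refine ⟨insert z N, ?_, ?_, ?_⟩
    · exact Finset.insert_subset hz.1 hN
    · rw [Finset.card_insert_of_notMem hz.2, hc]
    · intro x hx y hy hyN
      rw [Finset.mem_insert, not_or] at hyN
      rcases Finset.mem_insert.1 hx with rfl | hx
      · exact hmin y (Finset.mem_sdiff.2 ⟨hy, hyN.2⟩)
      · exact hlow x hx y hy hyN.2

open Classical in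
lemma exists_partial_hitting {ι : Type*} [Fintype ι] (A : Finset V) (N : ι → Finset V) (b : ℕ)
    (hb : 1 ≤ b) (hA : b ≤ A.card) (hN : ∀ i, N i ⊆ A ∧ (N i).card = b) (t : ℕ) :
    ∃ B ⊆ A, B.card ≤ t ∧
      ((Finset.univ.filter fun i => Disjoint B (N i)).card : ℝ) ≤
        Fintype.card ι * (1 - (b : ℝ) / A.card) ^ t := by
  have hApos : (0 : ℝ) < A.card := by exact_mod_cast (by omega : 0 < A.card)
  induction t with
  | zero => exact ⟨∅, by simp⟩
  | succ t ih =>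
    obtain ⟨B, hBA, hBt, hB⟩ := ih
    set F := Finset.univ.filter fun i => Disjoint B (N i) with hF
    have hAne : A.Nonempty := Finset.card_pos.1 (by omega)
    have hsum : ∑ x ∈ A, (F.filter fun i => x ∈ N i).card = F.card * b := by
      have := Finset.sum_card_bipartiteAbove_eq_sum_card_bipartiteBelow
        (s := A) (t := F) (fun x i => x ∈ N i)
      unfold Finset.bipartiteAbove Finset.bipartiteBelow at this
      rw [this, ← smul_eq_mul, ← Finset.sum_const]
      refine Finset.sum_congr rfl fun i _ => ?_
      rw [← (hN i).2]
      congr 1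
      ext x
      simp only [Finset.mem_filter, and_iff_right_iff_imp]
      exact fun h => (hN i).1 h
    obtain ⟨z, hzA, hz⟩ : ∃ z ∈ A, (F.card * b / A.card : ℝ) ≤
        ((F.filter fun i => z ∈ N i).card : ℝ) := by
      refine Finset.exists_le_of_sum_le hAne ?_
      rw [Finset.sum_const, nsmul_eq_mul, mul_div_cancel₀ _ hApos.ne']
      exact_mod_cast hsum.ge
    refine ⟨insert z B, Finset.insert_subset hzA hBA, (Finset.card_insert_le _ _).trans (by omega),
      ?_⟩
    have hsplit : (Finset.univ.filter fun i => Disjoint (insert z B) (N i)) =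
        F.filter fun i => z ∉ N i := by
      ext i
      simp [hF, Finset.disjoint_insert_left, and_comm]
    have hcard := Finset.card_filter_add_card_filter_not (s := F) (fun i => z ∈ N i)
    have hcard' : ((F.filter fun i => z ∈ N i).card : ℝ) +
      ((F.filter fun i => z ∉ N i).card : ℝ) = F.card := by exact_mod_cast hcard
    rw [hsplit]
    have hfac : 0 ≤ 1 - (b : ℝ) / A.card := by
      rw [sub_nonneg, div_le_one hApos]; exact_mod_cast hA
    calc ((F.filter fun i => z ∉ N i).card : ℝ)
        ≤ F.card - F.card * b / A.card := by linarith
      _ = F.card * (1 - (b : ℝ) / A.card) := by ring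
      _ ≤ (Fintype.card ι * (1 - (b : ℝ) / A.card) ^ t) * (1 - (b : ℝ) / A.card) := by gcongr
      _ = _ := by rw [pow_succ]; ring

lemma exists_hitting {ι : Type*} [Fintype ι] [Nonempty ι] (A : Finset V) (N : ι → Finset V)
    (b : ℕ) (hb : 1 ≤ b) (hA : b ≤ A.card) (hN : ∀ i, N i ⊆ A ∧ (N i).card = b) :
    ∃ B ⊆ A, (B.card : ℝ) ≤ A.card / b * (Real.log (Fintype.card ι) + 1) ∧
      ∀ i, ∃ z ∈ B, z ∈ N i := by
  classical
  have hApos : (0 : ℝ) < A.card := by exact_mod_cast (by omega : 0 < A.card)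
  have hbpos : (0 : ℝ) < b := by exact_mod_cast hb
  have hι : (0 : ℝ) < Fintype.card ι := by exact_mod_cast Fintype.card_pos
  set L := Real.log (Fintype.card ι) with hL
  have hL0 : 0 ≤ L := Real.log_nonneg (by exact_mod_cast Fintype.card_pos (α := ι))
  set t := ⌊A.card / b * L⌋₊ + 1 with ht
  have ht1 : A.card / b * L < t := by
    rw [ht]; push_cast; exact Nat.lt_floor_add_one _
  have ht2 : (t : ℝ) ≤ A.card / b * (L + 1) := by
    have h1 : (1 : ℝ) ≤ A.card / b := by rw [le_div_iff₀ hbpos]; simpa using hA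
    have h2 := Nat.floor_le (a := A.card / b * L) (by positivity)
    rw [ht]; push_cast; linarith
  obtain ⟨B, hBA, hBt, hB⟩ := exists_partial_hitting A N b hb hA hN t
  refine ⟨B, hBA, le_trans (by exact_mod_cast hBt) ht2, ?_⟩
  have hlt : (Fintype.card ι : ℝ) * (1 - (b : ℝ) / A.card) ^ t < 1 := by
    have hfac : 0 ≤ 1 - (b : ℝ) / A.card := by
      rw [sub_nonneg, div_le_one hApos]; exact_mod_cast hA
    have h1 : (1 - (b : ℝ) / A.card) ^ t ≤ Real.exp (-((b : ℝ) / A.card) * t) := by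
      rw [mul_comm, Real.exp_nat_mul]
      gcongr
      linarith [Real.add_one_le_exp (-((b : ℝ) / A.card))]
    have h2 : Real.exp (-((b : ℝ) / A.card) * t) < Real.exp (-L) := by
      rw [Real.exp_lt_exp, neg_mul, neg_lt_neg_iff]
      calc L = (b : ℝ) / A.card * (A.card / b * L) := by field_simp
        _ < _ := by gcongr
    calc _ < (Fintype.card ι : ℝ) * Real.exp (-L) := by
          gcongr; exact h1.trans_lt h2
      _ = 1 := by rw [Real.exp_neg, hL, Real.exp_log hι, mul_inv_cancel₀ hι.ne']
  intro i
  have h0 : (Finset.univ.filter fun i => Disjoint B (N i)).card = 0 := by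
    have := hB.trans_lt hlt
    have : (Finset.univ.filter fun i => Disjoint B (N i)).card < 1 := by exact_mod_cast this
    omega
  rw [Finset.card_eq_zero] at h0
  have : i ∉ Finset.univ.filter fun i => Disjoint B (N i) := by simp [h0]
  simpa [Finset.not_disjoint_iff] using this

open Classical in
/-- One sampling step: `B` is a sparse subset of `A` that hits all small balls. -/
lemma exists_sample [Fintype V] [Nonempty V] (δ : V → V → ℝ≥0∞) (A : Finset V) (q : ℝ)
    (hq : 0 < q) :
    ∃ B ⊆ A, (B.card : ℝ) ≤ A.card / q ∧
      ∀ v, ((A.filter fun x => ∀ z ∈ B, δ v x < δ v z).card : ℝ) ≤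
        q * (Real.log (Fintype.card V) + 1) := by
  set L := Real.log (Fintype.card V) with hL
  have hL0 : 0 ≤ L := Real.log_nonneg (by exact_mod_cast Fintype.card_pos (α := V))
  have hx : 0 < q * (L + 1) := by positivity
  set b := ⌈q * (L + 1)⌉₊ with hb
  have hb1 : 1 ≤ b := Nat.one_le_iff_ne_zero.2 (Nat.ceil_pos.2 hx).ne'
  have hb2 : (b : ℝ) < q * (L + 1) + 1 := Nat.ceil_lt_add_one hx.le
  have hb3 : q * (L + 1) ≤ b := Nat.le_ceil _
  by_cases hA : b ≤ A.card
  · choose N hN hNc hlow using fun v => exists_lowest A (δ v) b hA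
    obtain ⟨B, hBA, hBc, hhit⟩ := exists_hitting A N b hb1 hA fun v => ⟨hN v, hNc v⟩
    refine ⟨B, hBA, hBc.trans ?_, fun v => ?_⟩
    · have hbpos : (0 : ℝ) < b := by exact_mod_cast hb1
      rw [div_mul_eq_mul_div, div_le_div_iff₀ hbpos hq]
      have : (0 : ℝ) ≤ A.card := by positivity
      nlinarith
    · obtain ⟨z, hzB, hzN⟩ := hhit v
      have hsub : (A.filter fun x => ∀ z ∈ B, δ v x < δ v z) ⊆ (N v).erase z := by
        intro x hxm
        rw [Finset.mem_filter] at hxm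
        have hlt := hxm.2 z hzB
        rw [Finset.mem_erase]
        refine ⟨fun h => ?_, ?_⟩
        · subst h; exact lt_irrefl _ hlt
        · by_contra hxN
          exact absurd (hlow v z hzN x hxm.1 hxN) (not_le.2 hlt)
      have := Finset.card_le_card hsub
      rw [Finset.card_erase_of_mem hzN, hNc] at this
      have h3 : ((A.filter fun x => ∀ z ∈ B, δ v x < δ v z).card : ℝ) + 1 ≤ b := by
        exact_mod_cast (by omega : (A.filter fun x => ∀ z ∈ B, δ v x < δ v z).card + 1 ≤ b)
      linarith
  · refine ⟨∅, by simp, by simp; positivity, fun v => ?_⟩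
    have h3 : (A.card : ℝ) + 1 ≤ b := by exact_mod_cast (by omega : A.card + 1 ≤ b)
    simp only [Finset.notMem_empty, false_imp_iff, implies_true, Finset.filter_true]
    linarith

open Classical in
lemma exists_seq [Fintype V] [Nonempty V] (δ : V → V → ℝ≥0∞) (S : Finset V) (q : ℝ)
    (hq : 0 < q) (K : ℕ) (hK : 1 ≤ K) :
    ∃ A : ℕ → Finset V, A 0 = S ∧ (∀ i, A (i + 1) ⊆ A i) ∧ A K = ∅ ∧
      (∀ i, i + 1 < K → ∀ v, (((A i).filter fun x => ∀ z ∈ A (i + 1), δ v x < δ v z).card : ℝ) ≤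
        q * (Real.log (Fintype.card V) + 1)) ∧
      ((A (K - 1)).card : ℝ) ≤ S.card / q ^ (K - 1) := by
  choose f hf1 hf2 hf3 using fun A => exists_sample δ A q hq
  let A : ℕ → Finset V := fun i => f^[i] S
  have hA : ∀ i, A (i + 1) = f (A i) := fun i => Function.iterate_succ_apply' f i S
  have hsize : ∀ i, ((A i).card : ℝ) ≤ S.card / q ^ i := by
    intro i
    induction i with
    | zero => simp [A]
    | succ i ih =>
      rw [hA]
      refine (hf2 _).trans ?_
      rw [pow_succ, ← div_div]
      gcongr
  refine ⟨fun i => if i < K then A i else ∅, ?_, ?_, ?_, ?_, ?_⟩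
  · dsimp only
    rw [if_pos (by omega)]; rfl
  · intro i
    dsimp only
    by_cases h : i + 1 < K
    · rw [if_pos h, if_pos (by omega), hA]; exact hf1 _
    · rw [if_neg h]; simp
  · simp
  · intro i hi v
    have := hf3 (A i) v
    simp only [if_pos hi, if_pos (by omega : i < K), hA]
    convert this
  · dsimp only
    rw [if_pos (by omega)]
    exact hsize _
end Cover
section Cover2
variable {G : SimpleGraph V} {w : Sym2 V → ℝ≥0}

lemma gdist_pos [Finite V] (hw : ∀ e ∈ G.edgeSet, 0 < w e) {a b : V} (hab : a ≠ b) :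
    0 < gdist G w a b := by
  by_cases h : G.Reachable a b
  · obtain ⟨c, hc, hd⟩ := exists_next (w := w) h hab
    rw [hd]
    exact lt_of_lt_of_le (by exact_mod_cast hw _ (G.mem_edgeSet.2 hc)) le_self_add
  · rw [← gdist_lt_top (w := w), not_lt, top_le_iff] at h
    rw [h]; exact ENNReal.zero_lt_top

/-- The cluster of `s`, cut off by the set `B`. -/
def cluster (G : SimpleGraph V) (w : Sym2 V → ℝ≥0) (B : Finset V) (s : V) : Set V :=
  {x | gdist G w x s < ⊤ ∧ ∀ z ∈ B, gdist G w x s < gdist G w x z}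

lemma exists_cluster_tree [Finite V] (hw : ∀ e ∈ G.edgeSet, 0 < w e) (B : Finset V) (s : V)
    (hs : s ∉ B) :
    ∃ T : RootedTree G, T.root = s ∧ T.tree.verts = cluster G w B s ∧
      ∀ x ∈ cluster G w B s, T.depth w x ≤ gdist G w s x := by
  classical
  have hex : ∀ x, ∃ c, x ∈ cluster G w B s → x ≠ s →
      G.Adj x c ∧ gdist G w x s = w s(x, c) + gdist G w c s := by
    intro x
    by_cases h : x ∈ cluster G w B s ∧ x ≠ s
    · obtain ⟨c, hc⟩ := exists_next (w := w) (gdist_lt_top.1 h.1.1) h.2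
      exact ⟨c, fun _ _ => hc⟩
    · exact ⟨x, fun h1 h2 => absurd ⟨h1, h2⟩ h⟩
  choose par hpar using hex
  refine exists_tree hw s _ ?_ par ?_ fun x hx => hx.1
  · refine ⟨by simp [gdist_self], fun z hz => ?_⟩
    rw [gdist_self]
    exact gdist_pos hw (fun h => hs (h ▸ hz))
  · intro x hx hxs
    obtain ⟨h1, h2⟩ := hpar x hx hxs
    refine ⟨⟨?_, fun z hz => ?_⟩, h1, h2⟩
    · refine lt_of_le_of_lt ?_ hx.1
      rw [h2]; exact le_add_self
    · by_contra hle
      rw [not_lt] at hle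
      have h3 := hx.2 z hz
      rw [h2] at h3
      refine absurd h3 (not_lt.2 ?_)
      refine (gdist_triangle x (par x) z).trans ?_
      exact add_le_add (gdist_adj h1) hle

open Classical in
lemma exists_cover_of_seq [Fintype V] (hw : ∀ e ∈ G.edgeSet, 0 < w e) (K : ℕ) (A : ℕ → Finset V)
    (hA : ∀ i, A (i + 1) ⊆ A i) (hK : A K = ∅) :
    ∃ T : (A 0 : Set V) → RootedTree G, (∀ s, (T s).root = s) ∧
      (∀ u ∈ A 0, ∀ v, G.Reachable u v → ∃ s, u ∈ (T s).tree.verts ∧ v ∈ (T s).tree.verts ∧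
        (T s).depth w u + (T s).depth w v ≤ ((2 * (K - 1) + 1 : ℕ) : ℝ≥0∞) * gdist G w u v) ∧
      ∀ v, {s | v ∈ (T s).tree.verts}.ncard ≤ ∑ i ∈ Finset.range K,
        ((A i).filter fun x => ∀ z ∈ A (i + 1), gdist G w v x < gdist G w v z).card := by
  have hanti : Antitone A := antitone_nat_of_succ_le hA
  let rk : V → ℕ := fun x => Nat.findGreatest (fun i => x ∈ A i) K
  have hrk : ∀ x ∈ A 0, x ∈ A (rk x) := fun x hx =>
    Nat.findGreatest_spec (P := fun i => x ∈ A i) (Nat.zero_le K) hx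
  have hrkK : ∀ x ∈ A 0, rk x < K := by
    intro x hx
    refine lt_of_le_of_ne (Nat.findGreatest_le K) fun h => ?_
    have := hrk x hx
    rw [h, hK] at this
    simp at this
  have hrkle : ∀ x i, x ∈ A i → i ≤ rk x := by
    intro x i hx
    refine Nat.le_findGreatest ?_ hx
    by_contra h
    have := hanti (by omega : K ≤ i) hx
    rw [hK] at this
    simp at this
  have hrk' : ∀ x, x ∉ A (rk x + 1) := fun x hx => by
    have := hrkle x _ hx; omega
  choose T hT1 hT2 hT3 using fun s : (A 0 : Set V) =>
    exists_cluster_tree hw (A (rk s.1 + 1)) s.1 (hrk' s.1)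
  refine ⟨T, hT1, ?_, ?_⟩
  · have key : ∀ m : ℕ, ∀ a b x, x ∈ A 0 → K ≤ rk x + m → G.Reachable a b →
        a ∈ cluster G w (A (rk x + 1)) x → gdist G w a x ≤ (rk x : ℝ≥0∞) * gdist G w a b →
        ∃ y, ∃ hy : y ∈ A 0, a ∈ cluster G w (A (rk y + 1)) y ∧
          b ∈ cluster G w (A (rk y + 1)) y ∧
          gdist G w a y + gdist G w b y ≤ ((2 * (K - 1) + 1 : ℕ) : ℝ≥0∞) * gdist G w a b := by
      intro m
      induction m with
      | zero =>
        intro a b x hx hm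
        have := hrkK x hx
        omega
      | succ m ih =>
        intro a b x hx hm hab hax hd
        have hab' := (gdist_lt_top (w := w)).2 hab
        have hbx : gdist G w b x ≤ gdist G w a b + gdist G w a x := by
          rw [gdist_comm a b]; exact gdist_triangle b a x
        have hbx' : gdist G w b x < ⊤ := hbx.trans_lt (ENNReal.add_lt_top.2 ⟨hab', hax.1⟩)
        by_cases hb : b ∈ cluster G w (A (rk x + 1)) x
        · refine ⟨x, hx, hax, hb, ?_⟩
          have hr : rk x ≤ K - 1 := by have := hrkK x hx; omega
          calc gdist G w a x + gdist G w b x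
              ≤ rk x * gdist G w a b + (gdist G w a b + rk x * gdist G w a b) := by
                gcongr
                exact hbx.trans (by gcongr)
            _ = ((2 * rk x + 1 : ℕ) : ℝ≥0∞) * gdist G w a b := by push_cast; ring
            _ ≤ _ := by gcongr
        · have hex : ∃ z ∈ A (rk x + 1), gdist G w b z ≤ gdist G w b x := by
            by_contra hcon
            push Not at hcon
            exact hb ⟨hbx', hcon⟩
          obtain ⟨z, hz, hzle⟩ := hex
          obtain ⟨y0, hy0, hmin⟩ :=
            Finset.exists_min_image (A (rk x + 1)) (fun z => gdist G w b z) ⟨z, hz⟩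
          obtain ⟨y, hy, hmax⟩ := Finset.exists_max_image
            ((A (rk x + 1)).filter fun z => gdist G w b z = gdist G w b y0) rk
            ⟨y0, Finset.mem_filter.2 ⟨hy0, rfl⟩⟩
          rw [Finset.mem_filter] at hy
          have hyr := hrkle y _ hy.1
          have hyx : gdist G w b y ≤ gdist G w b x := by
            rw [hy.2]; exact (hmin z hz).trans hzle
          have hyc : b ∈ cluster G w (A (rk y + 1)) y := by
            refine ⟨hyx.trans_lt hbx', fun t ht => ?_⟩
            have ht1 : t ∈ A (rk x + 1) := hanti (by omega) ht
            rw [hy.2]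
            refine lt_of_le_of_ne (hmin t ht1) fun heq => ?_
            have h1 := hmax t (Finset.mem_filter.2 ⟨ht1, heq.symm⟩)
            have h2 := hrkle t _ ht
            omega
          have hd' : gdist G w b y ≤ (rk y : ℝ≥0∞) * gdist G w b a := by
            rw [gdist_comm b a]
            calc gdist G w b y ≤ gdist G w a b + rk x * gdist G w a b :=
                  hyx.trans (hbx.trans (by gcongr))
              _ = ((rk x + 1 : ℕ) : ℝ≥0∞) * gdist G w a b := by push_cast; ring
              _ ≤ _ := by gcongr
          obtain ⟨t, ht, h1, h2, h3⟩ :=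
            ih b a y (hanti (Nat.zero_le _) hy.1) (by omega) hab.symm hyc hd'
          refine ⟨t, ht, h2, h1, ?_⟩
          rw [add_comm, gdist_comm a b]
          exact h3
    intro u hu v huv
    have hu' : u ∈ cluster G w (A (rk u + 1)) u := by
      refine ⟨by simp [gdist_self], fun z hz => ?_⟩
      rw [gdist_self]
      exact gdist_pos hw (fun h => hrk' u (h ▸ hz))
    obtain ⟨y, hy, h1, h2, h3⟩ := key K u v u hu (by omega) huv hu' (by simp [gdist_self])
    refine ⟨⟨y, hy⟩, by rw [hT2]; exact h1, by rw [hT2]; exact h2, ?_⟩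
    refine le_trans (add_le_add (hT3 _ _ h1) (hT3 _ _ h2)) ?_
    rw [gdist_comm _ u, gdist_comm _ v]
    exact h3
  · intro v
    have himg : (Subtype.val '' {s | v ∈ (T s).tree.verts}) ⊆
        ((Finset.range K).biUnion fun i =>
          (A i).filter fun x => ∀ z ∈ A (i + 1), gdist G w v x < gdist G w v z : Finset V) := by
      rintro _ ⟨s, hs, rfl⟩
      have hs' : v ∈ cluster G w (A (rk s.1 + 1)) s.1 := by rw [← hT2]; exact hs
      rw [Finset.mem_coe, Finset.mem_biUnion]
      exact ⟨rk s.1, Finset.mem_range.2 (hrkK _ s.2),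
        Finset.mem_filter.2 ⟨hrk _ s.2, hs'.2⟩⟩
    rw [← Set.ncard_image_of_injective _ Subtype.val_injective]
    refine (Set.ncard_le_ncard himg (Finset.finite_toSet _)).trans ?_
    rw [Set.ncard_coe_finset]
    exact Finset.card_biUnion_le

/-- The numerical estimate behind the bound on the overlap of the trees. -/
lemma numeric {L : ℝ} (hL : 1 ≤ L) (K : ℕ) (hK : K = ⌊L⌋₊) :
    ((K - 1 : ℕ) : ℝ) * (Real.exp (L / K) * (L + 1)) + Real.exp (L / K) ≤
      L * Real.exp 1 * (L + 1) := by
  have hK1 : 1 ≤ K := by rw [hK]; exact Nat.le_floor (by exact_mod_cast hL)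
  have hKL : (K : ℝ) ≤ L := by rw [hK]; exact Nat.floor_le (by linarith)
  have hLK : L < K + 1 := by rw [hK]; exact Nat.lt_floor_add_one _
  have hK1' : (1 : ℝ) ≤ K := by exact_mod_cast hK1
  rw [Nat.cast_sub hK1, Nat.cast_one]
  obtain ⟨θ, hθ⟩ : ∃ θ, L = K + θ := ⟨L - K, by ring⟩
  have hθ0 : 0 ≤ θ := by linarith
  have hθ1 : θ < 1 := by linarith
  set E := Real.exp (θ / K) with hE
  have hsplit : Real.exp (L / K) = Real.exp 1 * E := by
    rw [hE, ← Real.exp_add]; congr 1; rw [hθ]; field_simp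
  have hEpos : 0 < E := Real.exp_pos _
  have hE1 : E * (K - θ) ≤ K := by
    have h1 : 1 - θ / K ≤ Real.exp (-(θ / K)) := by
      have := Real.add_one_le_exp (-(θ / K)); linarith
    have h2 : E * (1 - θ / K) ≤ 1 := by
      calc E * (1 - θ / K) ≤ E * Real.exp (-(θ / K)) := by gcongr
        _ = 1 := by rw [hE, ← Real.exp_add]; simp
    calc E * (K - θ) = E * (1 - θ / K) * K := by field_simp
      _ ≤ 1 * K := by gcongr
      _ = K := one_mul _
  have hE2 : (K - 1) * E ≤ L - 1 := by
    have hpos : 0 < (K : ℝ) - θ := by linarith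
    rw [← mul_le_mul_iff_left₀ hpos]
    calc (K - 1) * E * (K - θ) = (K - 1) * (E * (K - θ)) := by ring
      _ ≤ (K - 1) * K := by
        apply mul_le_mul_of_nonneg_left hE1; linarith
      _ ≤ (L - 1) * (K - θ) := by rw [hθ]; nlinarith
  have hE3 : E ≤ L + 1 := by
    have h1 : E ≤ Real.exp 1 := by
      rw [hE, Real.exp_le_exp, div_le_one (by linarith)]; linarith
    by_cases h2 : 2 ≤ K
    · have : (2 : ℝ) ≤ K := by exact_mod_cast h2
      have := Real.exp_one_lt_d9
      linarith
    · have hKe : K = 1 := by omega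
      have : E = Real.exp θ := by rw [hE, hKe]; simp
      rw [this, hθ, hKe]
      have hb := Real.abs_exp_sub_one_sub_id_le (x := θ) (by rw [abs_of_nonneg hθ0]; exact hθ1.le)
      have := (abs_le.1 hb).2
      push_cast
      nlinarith
  rw [hsplit]
  have he : 0 < Real.exp 1 := Real.exp_pos _
  have : (K - 1) * E * (L + 1) + E ≤ L * (L + 1) := by
    nlinarith
  calc _ = Real.exp 1 * ((K - 1) * E * (L + 1) + E) := by ring
    _ ≤ Real.exp 1 * (L * (L + 1)) := by gcongr
    _ = _ := by ring

open Classical in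
lemma TreeCover.nonempty [Fintype V] (hn : 3 ≤ Fintype.card V)
    (hw : ∀ e ∈ G.edgeSet, 0 < w e) (S : Set V) : Nonempty (TreeCover G w S) := by
  have : Nonempty V := Fintype.card_pos_iff.1 (by omega)
  have hn' : (3 : ℝ) ≤ Fintype.card V := by exact_mod_cast hn
  have hnpos : (0 : ℝ) < Fintype.card V := by linarith
  obtain ⟨L, hL⟩ : ∃ L, L = Real.log (Fintype.card V) := ⟨_, rfl⟩
  have hL1 : 1 ≤ L := by
    rw [hL, Real.le_log_iff_exp_le hnpos]
    have := Real.exp_one_lt_d9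
    linarith
  obtain ⟨K, hK⟩ : ∃ K, K = ⌊L⌋₊ := ⟨_, rfl⟩
  have hK1 : 1 ≤ K := by rw [hK]; exact Nat.le_floor (by exact_mod_cast hL1)
  have hKL : (K : ℝ) ≤ L := by rw [hK]; exact Nat.floor_le (by linarith)
  have hKpos : (0 : ℝ) < K := by exact_mod_cast hK1
  obtain ⟨A, hA0, hA, hAK, hAb, hAlast⟩ := exists_seq (gdist G w) S.toFinset
    (Real.exp (L / K)) (Real.exp_pos _) K hK1
  obtain ⟨T, hT1, hT2, hT3⟩ := exists_cover_of_seq hw K A hA hAK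
  have hS : (A 0 : Set V) = S := by rw [hA0]; simp
  have hfin : ∀ v, ({s | v ∈ (T s).tree.verts}.ncard : ℝ) ≤ kParam V *
      (Fintype.card V : ℝ) ^ (1 / kParam V) * (Real.log (Fintype.card V) + 1) := by
    intro v
    have hpow : (Fintype.card V : ℝ) ^ (1 / kParam V) = Real.exp 1 := by
      rw [Real.rpow_def_of_pos hnpos, kParam, mul_one_div_cancel]
      rw [← hL]; linarith
    rw [hpow, kParam, ← hL]
    refine le_trans ?_ (numeric hL1 K hK)
    refine le_trans (Nat.cast_le.2 (hT3 v)) ?_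
    obtain ⟨m, rfl⟩ : ∃ m, K = m + 1 := ⟨K - 1, by omega⟩
    rw [Finset.sum_range_succ, Nat.cast_add]
    refine add_le_add ?_ ?_
    · rw [Nat.cast_sum]
      refine (Finset.sum_le_card_nsmul _ _ (Real.exp (L / (m + 1 : ℕ)) * (L + 1)) ?_).trans ?_
      · intro i hi
        rw [Finset.mem_range] at hi
        have := hAb i (by omega) v
        rw [← hL] at this
        exact this
      · simp [nsmul_eq_mul]
    · refine le_trans (Nat.cast_le.2 (Finset.card_filter_le _ _)) ?_
      refine le_trans hAlast ?_
      have h1 : (S.toFinset.card : ℝ) ≤ Fintype.card V := by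
        exact_mod_cast Finset.card_le_univ _
      rw [div_le_iff₀ (by positivity)]
      refine h1.trans (le_of_eq ?_)
      rw [Nat.add_sub_cancel, ← pow_succ', ← Real.exp_nat_mul, mul_div_cancel₀ _ hKpos.ne', hL,
        Real.exp_log hnpos]
  have hst : ∀ u ∈ A 0, ∀ v, G.Reachable u v → ∃ s, u ∈ (T s).tree.verts ∧
      v ∈ (T s).tree.verts ∧ (T s).depth w u + (T s).depth w v ≤
        ENNReal.ofReal (2 * kParam V - 1) * gdist G w u v := by
    intro u hu v huv
    obtain ⟨s, h1, h2, h3⟩ := hT2 u hu v huv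
    refine ⟨s, h1, h2, h3.trans ?_⟩
    gcongr
    rw [← ENNReal.ofReal_natCast]
    apply ENNReal.ofReal_le_ofReal
    rw [kParam, ← hL]
    push_cast [Nat.cast_sub hK1]
    linarith
  subst hS
  exact ⟨⟨T, hT1, fun u hu => hst u hu, hfin⟩⟩

/-- Covers and shortest paths as required exist for every input graph. -/
theorem Choices.nonempty [Fintype V] (hn : 3 ≤ Fintype.card V)
    (hw : ∀ e ∈ G.edgeSet, 0 < w e) : Nonempty (Choices G w) := by
  classical
  have hw' : ∀ R : Set V, ∀ e ∈ (delVerts G R).edgeSet, 0 < w e := by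
    intro R e
    induction e with
    | _ a b => exact fun h => hw _ (G.mem_edgeSet.2 h.1)
  exact ⟨{
    cover := fun R S => (TreeCover.nonempty hn (hw' R) (S \ R)).some
    path := fun A x y => if h : (delVerts G A).Reachable x y then
      some (exists_shortest (w := w) h).choose else none
    path_none := by intro A x y; simp
    path_shortest := by
      intro A x y P hP
      by_cases h : (delVerts G A).Reachable x y
      · rw [dif_pos h] at hP
        obtain rfl := Option.some.inj hP
        exact (exists_shortest (w := w) h).choose_spec
      · rw [dif_neg h] at hP
        cases hP }⟩
end Cover2

end VSDO

/-!
Going from `x` towards `y` along a shortest path `P` of `G - D`, let `z` be the first vertex that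
has a vertex of `H` within `ε₁` times its distance from `x`, and let `q` be the vertex of `H`
nearest to `z`. The query `DecTree(x, q, D)` does no worse than the walk that follows `P` to `z` and
then goes straight to `q`, because a query fails to find a walk only if some inner vertex of the
walk is close, relative to its distance from either end, to a vertex of `H`: the segment that is cut
out contains a failure `f`, and a tree of the cover for the highest level met on the way from the
inner vertex to `f` leads back from a failure to one of its neighbours in `H`. Here the `2k - 1` of
the tree covers cancels against the one in `ε₂`. So one edge of `H` of length at most
`(1 + ε₁) |P[x, z]|` moves the current vertex from `x` to `q`, and the remaining distance decreases
by at least `(1 - ε₁) |P[x, z]|`; the quotient of the two factors is `1 + ε`.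
-/

namespace VSDO

section Walks

variable {V : Type*} {G H : SimpleGraph V} {w : Sym2 V → ℝ≥0}

lemma len_append {a b c : V} (P : G.Walk a b) (Q : G.Walk b c) :
    len w (P.append Q) = len w P + len w Q := by
  simp [len]

lemma len_reverse {a b : V} (P : G.Walk a b) : len w P.reverse = len w P := by
  simp [len]

lemma len_cons {a b c : V} (h : G.Adj a b) (P : G.Walk b c) :
    len w (P.cons h) = w s(a, b) + len w P := by
  simp [len]

lemma len_pos (hw : ∀ e ∈ G.edgeSet, 0 < w e) {a b : V} (P : G.Walk a b) (hab : a ≠ b) :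
    0 < len w P := by
  cases P with
  | nil => exact absurd rfl hab
  | cons h P =>
    rw [len_cons]
    exact (hw _ h).trans_le le_self_add

lemma gdist_le_len {a b : V} (P : G.Walk a b) : gdist G w a b ≤ len w P := iInf_le _ P

lemma IsShortestPath.takeUntil [DecidableEq V] {a b z : V} {P : G.Walk a b}
    (hP : IsShortestPath w P) (hz : z ∈ P.support) : IsShortestPath w (P.takeUntil z hz) := by
  refine ⟨hP.1.takeUntil hz, fun Q => ?_⟩
  have hle := hP.2 (Q.append (P.dropUntil z hz))
  rw [← congrArg (len w) (P.take_spec hz), len_append, len_append] at hle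
  exact le_of_add_le_add_right hle

lemma IsShortestPath.dropUntil [DecidableEq V] {a b z : V} {P : G.Walk a b}
    (hP : IsShortestPath w P) (hz : z ∈ P.support) : IsShortestPath w (P.dropUntil z hz) := by
  refine ⟨hP.1.dropUntil hz, fun Q => ?_⟩
  have hle := hP.2 ((P.takeUntil z hz).append Q)
  rw [← congrArg (len w) (P.take_spec hz), len_append, len_append] at hle
  exact le_of_add_le_add_left hle

lemma exists_eq_append_cons_of_mem_support {D : Set V} {a b f : V} (P : G.Walk a b) (ha : a ∉ D)
    (hf : f ∈ D) (hfP : f ∈ P.support) :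
    ∃ (q f' : V) (P₁ : G.Walk a q) (h : G.Adj q f') (P₂ : G.Walk f' b),
      P = P₁.append (P₂.cons h) ∧ (∀ t ∈ P₁.support, t ∉ D) ∧ f' ∈ D := by
  induction P with
  | nil => exact absurd (List.mem_singleton.1 hfP ▸ hf) ha
  | @cons a c b h P ih =>
    by_cases hc : c ∈ D
    · exact ⟨a, c, .nil, h, P, rfl, by simpa using ha, hc⟩
    · have hfP' : f ∈ P.support := (List.mem_cons.1 hfP).resolve_left fun e => ha (e ▸ hf)
      obtain ⟨q, f', P₁, h', P₂, rfl, hP₁, hf'⟩ := ih hc hfP'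
      exact ⟨q, f', P₁.cons h, h', P₂, rfl, List.forall_mem_cons.2 ⟨ha, hP₁⟩, hf'⟩

lemma delVerts_le (G : SimpleGraph V) (R : Set V) : delVerts G R ≤ G := fun _ _ h => h.1

lemma weight_pos_delVerts (hw : ∀ e ∈ G.edgeSet, 0 < w e) (R : Set V) :
    ∀ e ∈ (delVerts G R).edgeSet, 0 < w e :=
  fun e he => hw e (SimpleGraph.edgeSet_mono (delVerts_le G R) he)

/-- The start `a` has to be excluded because of the trivial walk. -/
lemma notMem_of_mem_support_delVerts {R : Set V} {a b t : V} (P : (delVerts G R).Walk a b)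
    (ht : t ∈ P.support) (hta : t ≠ a) : t ∉ R := by
  induction P with
  | nil => exact absurd (List.mem_singleton.1 ht) hta
  | @cons a c b h P ih =>
    rcases eq_or_ne t c with rfl | htc
    · exact h.2.2
    · exact ih ((List.mem_cons.1 ht).resolve_left hta) htc

lemma exists_walk_delVerts_len_eq (hH : H ≤ G) {R : Set V} {a b : V} (P : H.Walk a b)
    (hP : ∀ t ∈ P.support, t ∉ R) : ∃ Q : (delVerts G R).Walk a b, len w Q = len w P := by
  have hedges : ∀ e ∈ P.edges, e ∈ (delVerts G R).edgeSet := by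
    intro e
    induction e with
    | _ x y =>
      exact fun he => ⟨hH (P.adj_of_mem_edges he), hP _ (P.fst_mem_support_of_mem_edges he),
        hP _ (P.snd_mem_support_of_mem_edges he)⟩
  exact ⟨P.transfer _ hedges, by simp [len]⟩

lemma gdist_delVerts_le_len (hH : H ≤ G) {R : Set V} {a b : V} (P : H.Walk a b)
    (hP : ∀ t ∈ P.support, t ∉ R) : gdist (delVerts G R) w a b ≤ len w P := by
  obtain ⟨Q, hQ⟩ := exists_walk_delVerts_len_eq (w := w) hH P hP
  exact hQ ▸ gdist_le_len Q

end Walks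

section Trees

variable {V : Type*} {G H : SimpleGraph V} {w : Sym2 V → ℝ≥0}

namespace RootedTree

lemma reachable (T : RootedTree G) {a b : V} (ha : a ∈ T.tree.verts) (hb : b ∈ T.tree.verts) :
    T.tree.spanningCoe.Reachable a b :=
  (T.isTree.connected ⟨a, ha⟩ ⟨b, hb⟩).map
    (⟨Subtype.val, fun h => h⟩ : T.tree.coe →g T.tree.spanningCoe)

lemma spanningCoe_le (T : RootedTree H) (hH : H ≤ G) : T.tree.spanningCoe ≤ G :=
  fun _ _ h => hH (T.tree.adj_sub h)

lemma exists_isPath_len_eq_depth [Finite V] (T : RootedTree G) (w : Sym2 V → ℝ≥0) {a : V}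
    (ha : a ∈ T.tree.verts) :
    ∃ P : T.tree.spanningCoe.Walk T.root a, P.IsPath ∧ len w P = T.depth w a := by
  obtain ⟨P, hP⟩ := exists_shortest (w := w) (T.reachable T.root_mem ha)
  exact ⟨P, hP.1, hP.gdist_eq.symm⟩

lemma mem_verts_of_mem_nbrs {T : RootedTree G} {S : Set V} {f q : V} (hq : q ∈ T.nbrs S f) :
    f ∈ T.tree.verts := by
  rcases hq with ⟨h, -⟩ | ⟨⟨h, -⟩, -⟩
  exacts [T.tree.edge_vert h, T.tree.edge_vert (T.tree.adj_symm h)]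

lemma exists_mem_nbrs_of_walk_to_root (hH : H ≤ G) (T : RootedTree H) {S D : Set V}
    (hrS : T.root ∈ S) {g f : V} (hgS : g ∈ S) (hgT : g ∈ T.tree.verts) (hgD : g ∉ D)
    {P : T.tree.spanningCoe.Walk g T.root} (hP : P.IsPath) (hfP : f ∈ P.support) (hfD : f ∈ D) :
    ∃ f' ∈ D, ∃ q ∈ T.nbrs S f', q ∉ D ∧ gdist (delVerts G D) w g q ≤ len w P := by
  obtain ⟨q, f', P₁, h, P₂, rfl, hP₁, hf'⟩ := exists_eq_append_cons_of_mem_support P hgD hfD hfP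
  have hparent : T.IsParent f' q := ⟨h, P₂, hP.of_append_right⟩
  have htrunk : q ∈ T.trunk S := ⟨g, hgS, T.root, hrS, hgT, T.root_mem, _, hP, by simp⟩
  refine ⟨f', hf', q, Or.inr ⟨hparent, htrunk⟩, hP₁ q P₁.end_mem_support, ?_⟩
  refine (gdist_delVerts_le_len (T.spanningCoe_le hH) P₁ hP₁).trans (ENNReal.coe_le_coe.2 ?_)
  exact len_append (w := w) P₁ _ ▸ le_self_add

lemma exists_isParent_of_walk_from_root (hH : H ≤ G) (T : RootedTree H) {D : Set V}
    (hrD : T.root ∉ D) {f : V} (hfD : f ∈ D)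
    {P : T.tree.spanningCoe.Walk T.root f} (hP : P.IsPath) :
    ∃ f' ∈ D, ∃ q, T.IsParent q f' ∧ q ∉ D ∧ gdist (delVerts G D) w T.root q ≤ len w P := by
  obtain ⟨q, f', P₁, h, P₂, rfl, hP₁, hf'⟩ :=
    exists_eq_append_cons_of_mem_support P hrD hfD P.end_mem_support
  have hpath : (SimpleGraph.Walk.cons h.symm P₁.reverse).IsPath := by
    rw [← SimpleGraph.Walk.concat_append] at hP
    simpa only [SimpleGraph.Walk.reverse_concat] using hP.of_append_left.reverse
  refine ⟨f', hf', q, ⟨h.symm, P₁.reverse, hpath⟩, hP₁ q P₁.end_mem_support, ?_⟩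
  refine (gdist_delVerts_le_len (T.spanningCoe_le hH) P₁ hP₁).trans (ENNReal.coe_le_coe.2 ?_)
  exact len_append (w := w) P₁ _ ▸ le_self_add

/-- The tree walk from `g` through the root to `f` meets `D` for the first time either on its way
up, right after a trunk child of a failure, or on its way down, right after the parent of one. -/
lemma exists_mem_nbrs_gdist_le [Finite V] (hH : H ≤ G) (T : RootedTree H) {S D : Set V}
    (hrS : T.root ∈ S) {g f : V} (hgS : g ∈ S) (hgD : g ∉ D) (hfD : f ∈ D)
    (hgT : g ∈ T.tree.verts) (hfT : f ∈ T.tree.verts) :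
    ∃ f' ∈ D, ∃ q ∈ T.nbrs S f', q ∉ D ∧
      gdist (delVerts G D) w g q ≤ T.depth w g + T.depth w f := by
  obtain ⟨P, hP, hPlen⟩ := T.exists_isPath_len_eq_depth w hgT
  obtain ⟨Q, hQ, hQlen⟩ := T.exists_isPath_len_eq_depth w hfT
  rw [← hPlen, ← hQlen, ← len_reverse P]
  by_cases hPD : ∃ t ∈ P.reverse.support, t ∈ D
  · obtain ⟨t, htP, htD⟩ := hPD
    obtain ⟨f', hf', q, hq, hqD, hle⟩ :=
      T.exists_mem_nbrs_of_walk_to_root hH hrS hgS hgT hgD hP.reverse htP htD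
    exact ⟨f', hf', q, hq, hqD, hle.trans le_self_add⟩
  · push Not at hPD
    obtain ⟨f', hf', q, hq, hqD, hle⟩ :=
      T.exists_isParent_of_walk_from_root hH (hPD _ P.reverse.end_mem_support) hfD hQ
    exact ⟨f', hf', q, Or.inl hq, hqD, (gdist_triangle g T.root q).trans
      (add_le_add (gdist_delVerts_le_len (T.spanningCoe_le hH) _ hPD) hle)⟩

end RootedTree

lemma TreeCover.exists_mem_nbrs_gdist_le [Fintype V] {S D : Set V} (C : TreeCover H w S)
    (hH : H ≤ G) {g f : V} (hgS : g ∈ S) (hgD : g ∉ D) (hfD : f ∈ D) (Q : H.Walk g f) :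
    ∃ s, ∃ f' ∈ D, ∃ q ∈ (C.T s).nbrs S f', q ∉ D ∧
      gdist (delVerts G D) w g q ≤ ENNReal.ofReal (2 * kParam V - 1) * len w Q := by
  obtain ⟨s, hgT, hfT, hstretch⟩ := C.stretch g hgS f ⟨Q⟩
  have hrS : (C.T s).root ∈ S := C.root_eq s ▸ s.2
  obtain ⟨f', hf', q, hq, hqD, hle⟩ :=
    (C.T s).exists_mem_nbrs_gdist_le hH hrS hgS hgD hfD hgT hfT
  exact ⟨s, f', hf', q, hq, hqD, hle.trans (hstretch.trans (by gcongr; exact gdist_le_len Q))⟩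

end Trees

section Parameters

variable {V : Type*} [Fintype V] {ε : ℝ}

lemma one_le_two_mul_kParam_sub_one (hn : 3 ≤ Fintype.card V) :
    1 ≤ 2 * kParam V - 1 := by
  have hcard : (3 : ℝ) ≤ Fintype.card V := by exact_mod_cast hn
  have hk : 1 ≤ kParam V := by
    rw [kParam, Real.le_log_iff_exp_le (by linarith)]
    linarith [Real.exp_one_lt_d9]
  linarith

lemma eps2_pos (hn : 3 ≤ Fintype.card V) (hε : 0 < ε) : 0 < eps2 V ε := by
  have hk := one_le_two_mul_kParam_sub_one hn
  exact div_pos (by positivity) (by linarith)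

lemma ofReal_mul_ofReal_eps2 (hn : 3 ≤ Fintype.card V) :
    ENNReal.ofReal (2 * kParam V - 1) * ENNReal.ofReal (eps2 V ε) =
      ENNReal.ofReal (ε / (2 + ε)) := by
  have hk := one_le_two_mul_kParam_sub_one hn
  rw [← ENNReal.ofReal_mul (by linarith), eps2, mul_div_cancel₀ _ (by linarith)]

end Parameters

section Segments

lemma lt_mul_of_floor_logb_eq {b s t : ℝ} (hb : 1 < b) (hs : 0 < s) (ht : 0 < t)
    (h : ⌊Real.logb b s⌋ = ⌊Real.logb b t⌋) : s < b * t := by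
  have hlog := (abs_lt.1 (Int.abs_sub_lt_one_of_floor_eq_floor h)).2
  rw [← Real.logb_div hs.ne' ht.ne', Real.logb_lt_iff_lt_rpow hb (div_pos hs ht), Real.rpow_one,
    div_lt_iff₀ ht] at hlog
  exact hlog

lemma abs_sub_le_of_floor_logb_eq {b s t : ℝ} (hb : 1 < b) (hs : 0 < s) (ht : 0 < t)
    (h : ⌊Real.logb b s⌋ = ⌊Real.logb b t⌋) : |t - s| ≤ (b - 1) * t := by
  have hst := lt_mul_of_floor_logb_eq hb hs ht h
  have hts := lt_mul_of_floor_logb_eq hb ht hs h.symm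
  rw [abs_le]
  constructor <;> nlinarith

variable {V : Type*} [DecidableEq V] {G : SimpleGraph V} {w : Sym2 V → ℝ≥0}

lemma lenTo_eq {x y t : V} (P : G.Walk x y) (ht : t ∈ P.support) :
    lenTo w P t = len w (P.takeUntil t ht) := dif_pos ht

lemma lenFrom_eq {x y t : V} (P : G.Walk x y) (ht : t ∈ P.support) :
    lenFrom w P t = len w (P.dropUntil t ht) := dif_pos ht

lemma lenTo_add_lenFrom {x y t : V} (P : G.Walk x y) (ht : t ∈ P.support) :
    lenTo w P t + lenFrom w P t = len w P := by
  rw [lenTo_eq P ht, lenFrom_eq P ht, ← NNReal.coe_add, ← len_append, P.take_spec ht]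

lemma lenTo_pos (hw : ∀ e ∈ G.edgeSet, 0 < w e) {x y t : V} (P : G.Walk x y)
    (ht : t ∈ P.support) (htx : t ≠ x) : 0 < lenTo w P t := by
  rw [lenTo_eq P ht]
  exact_mod_cast len_pos hw _ htx.symm

lemma lenFrom_pos (hw : ∀ e ∈ G.edgeSet, 0 < w e) {x y t : V} (P : G.Walk x y)
    (ht : t ∈ P.support) (hty : t ≠ y) : 0 < lenFrom w P t := by
  rw [lenFrom_eq P ht]
  exact_mod_cast len_pos hw _ hty

lemma IsShortestPath.ofReal_lenTo {x y t : V} {P : G.Walk x y} (hP : IsShortestPath w P)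
    (ht : t ∈ P.support) : ENNReal.ofReal (lenTo w P t) = gdist G w x t := by
  rw [lenTo_eq P ht, (hP.takeUntil ht).gdist_eq, ENNReal.ofReal_coe_nnreal]

lemma IsShortestPath.ofReal_lenFrom {x y t : V} {P : G.Walk x y} (hP : IsShortestPath w P)
    (ht : t ∈ P.support) : ENNReal.ofReal (lenFrom w P t) = gdist G w t y := by
  rw [lenFrom_eq P ht, (hP.dropUntil ht).gdist_eq, ENNReal.ofReal_coe_nnreal]

lemma mem_support_takeUntil_or {x y s t : V} (P : G.Walk x y) (hs : s ∈ P.support)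
    (ht : t ∈ P.support) :
    s ∈ (P.takeUntil t ht).support ∨ t ∈ (P.takeUntil s hs).support :=
  (List.prefix_or_prefix_of_prefix (P.support_takeUntil_prefix_support hs)
    (P.support_takeUntil_prefix_support ht)).imp
    (fun h => h.subset (SimpleGraph.Walk.end_mem_support _))
    (fun h => h.subset (SimpleGraph.Walk.end_mem_support _))

lemma exists_walk_len_eq_abs_lenTo_sub {x y s t : V} (P : G.Walk x y) (hs : s ∈ P.support)
    (ht : t ∈ P.support) :
    ∃ Q : G.Walk s t, Q.support ⊆ P.support ∧ (len w Q : ℝ) = |lenTo w P s - lenTo w P t| := by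
  wlog h : s ∈ (P.takeUntil t ht).support generalizing s t
  · obtain ⟨Q, hQP, hQ⟩ := this ht hs ((mem_support_takeUntil_or P hs ht).resolve_left h)
    exact ⟨Q.reverse, by simpa using hQP, by rw [len_reverse, hQ, abs_sub_comm]⟩
  set P' := P.takeUntil t ht
  refine ⟨P'.dropUntil s h, List.Subset.trans (P'.support_dropUntil_subset_support h)
    (P.support_takeUntil_subset_support ht), ?_⟩
  have hsplit : len w P' = len w (P.takeUntil s hs) + len w (P'.dropUntil s h) := by
    rw [← P.takeUntil_takeUntil ht h, ← len_append, P'.take_spec h]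
  rw [lenTo_eq P hs, lenTo_eq P ht, hsplit, NNReal.coe_add, abs_sub_comm, add_sub_cancel_left,
    NNReal.abs_eq]

lemma exists_walk_of_mem_seg (hw : ∀ e ∈ G.edgeSet, 0 < w e) {e : ℝ} (he : 0 < e) {x y f z : V}
    {P : G.Walk x y} (hP : IsShortestPath w P) (hf : f ∈ P.support) (hfx : f ≠ x) (hfy : f ≠ y)
    (hz : z ∈ seg w e f P) :
    ∃ Q : G.Walk z f, Q.support ⊆ P.support ∧
      len w Q ≤ ENNReal.ofReal e * gdist G w x z ∧
      len w Q ≤ ENNReal.ofReal e * gdist G w z y := by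
  obtain ⟨hzP, hzx, hzy, hsame⟩ := hz
  obtain ⟨Q, hQP, hQ⟩ := exists_walk_len_eq_abs_lenTo_sub (w := w) P hzP hf
  have hfsum := lenTo_add_lenFrom (w := w) P hf
  have hzsum := lenTo_add_lenFrom (w := w) P hzP
  have hbound : (len w Q : ℝ) ≤ e * lenTo w P z ∧ (len w Q : ℝ) ≤ e * lenFrom w P z := by
    rcases hsame with ⟨-, hle, hfloor⟩ | ⟨-, hlt, hfloor⟩
    · have hto : (len w Q : ℝ) ≤ e * lenTo w P z := by
        simpa [hQ] using abs_sub_le_of_floor_logb_eq (by linarith) (lenTo_pos hw P hf hfx)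
          (lenTo_pos hw P hzP hzx) hfloor
      exact ⟨hto, hto.trans (by gcongr; linarith)⟩
    · have hfrom : (len w Q : ℝ) ≤ e * lenFrom w P z := by
        rw [hQ, abs_sub_comm, show lenTo w P f - lenTo w P z = lenFrom w P z - lenFrom w P f by
          linarith]
        simpa using abs_sub_le_of_floor_logb_eq (by linarith) (lenFrom_pos hw P hf hfy)
          (lenFrom_pos hw P hzP hzy) hfloor
      exact ⟨hfrom.trans (by gcongr; linarith), hfrom⟩
  refine ⟨Q, hQP, ?_⟩
  rw [← hP.ofReal_lenTo hzP, ← hP.ofReal_lenFrom hzP, ← ENNReal.ofReal_mul he.le,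
    ← ENNReal.ofReal_mul he.le, ← ENNReal.ofReal_coe_nnreal]
  exact hbound.imp ENNReal.ofReal_le_ofReal ENNReal.ofReal_le_ofReal

lemma mem_seg_self {e : ℝ} {x y f : V} (P : G.Walk x y) (hf : f ∈ P.support) (hfx : f ≠ x)
    (hfy : f ≠ y) : f ∈ seg w e f P := by
  have hsum := lenTo_add_lenFrom (w := w) P hf
  refine ⟨hf, hfx, hfy, ?_⟩
  rcases le_or_gt (lenTo w P f) (len w P / 2) with h | h
  · exact Or.inl ⟨h, h, rfl⟩
  · exact Or.inr ⟨by linarith, by linarith, rfl⟩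

end Segments

section Detours

variable {V : Type*} {G : SimpleGraph V} {w : Sym2 V → ℝ≥0} {e : ℝ≥0} {A : Set V}
  {r : V → ℝ≥0∞}

/-- The walk `P` has an `e`-detour to `A`: it has an inner vertex `z` such that some vertex of `A`
is within `e` times the length of either part into which `z` cuts `P`. If `P` visits `z` several
times, this is required for every visit. -/
def HasDetour (w : Sym2 V → ℝ≥0) (e : ℝ≥0) (A : Set V) {x y : V} (P : G.Walk x y) : Prop :=
  ∃ z ∈ P.support, z ≠ x ∧ z ≠ y ∧ ∃ q ∈ A,
    ∀ (P₁ : G.Walk x z) (P₂ : G.Walk z y), P = P₁.append P₂ →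
      gdist G w z q ≤ e * len w P₁ ∧ gdist G w z q ≤ e * len w P₂

/-- The walk `T` moves away from its start and ends `e`-near `A`: within `e` times its length of
a vertex of `A`. -/
def EndsNear (w : Sym2 V → ℝ≥0) (e : ℝ≥0) (A : Set V) {x z : V} (T : G.Walk x z) : Prop :=
  z ≠ x ∧ ∃ q ∈ A, gdist G w z q ≤ e * len w T

/-- No proper initial part of the walk `T` ends `e`-near `A`. -/
def NoShorterEndsNear (w : Sym2 V → ℝ≥0) (e : ℝ≥0) (A : Set V) {x z : V} (T : G.Walk x z) : Prop :=
  ∀ z' (T₁ : G.Walk x z') (T₂ : G.Walk z' z), T = T₁.append T₂ → EndsNear w e A T₁ → z' = z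

lemma HasDetour.exists_endsNear {x y : V} {P : G.Walk x y} (h : HasDetour w e A P) :
    ∃ (z : V) (T : G.Walk x z) (B : G.Walk z y), P = T.append B ∧ EndsNear w e A T := by
  obtain ⟨z, hzP, hzx, -, q, hq, hnear⟩ := h
  obtain ⟨T, B, rfl⟩ := SimpleGraph.Walk.mem_support_iff_exists_append.1 hzP
  exact ⟨z, T, B, rfl, hzx, q, hq, (hnear T B rfl).1⟩

lemma EndsNear.exists_noShorterEndsNear {x z : V} {T : G.Walk x z} (hT : EndsNear w e A T) :
    ∃ (z' : V) (T₁ : G.Walk x z') (T₂ : G.Walk z' z),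
      T = T₁.append T₂ ∧ EndsNear w e A T₁ ∧ NoShorterEndsNear w e A T₁ := by
  induction hlen : T.length using Nat.strong_induction_on generalizing z with
  | _ m ih =>
    by_cases hmin : NoShorterEndsNear w e A T
    · exact ⟨z, T, .nil, T.append_nil.symm, hT, hmin⟩
    · simp only [NoShorterEndsNear] at hmin
      push Not at hmin
      obtain ⟨z₁, T₁, T₂, rfl, hT₁, hz₁⟩ := hmin
      have hlt : T₁.length < m := by
        rw [← hlen, SimpleGraph.Walk.length_append]
        exact Nat.lt_add_of_pos_right (SimpleGraph.Walk.not_nil_iff_lt_length.1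
          (SimpleGraph.Walk.not_nil_of_ne hz₁))
      obtain ⟨z', S₁, S₂, rfl, hS₁, hmin'⟩ := ih _ hlt hT₁ rfl
      exact ⟨z', S₁, S₂.append T₂, (S₁.append_assoc S₂ T₂).symm, hS₁, hmin'⟩

lemma not_hasDetour_append (hw : ∀ e ∈ G.edgeSet, 0 < w e) (he : e < 1) {x z q : V}
    {T : G.Walk x z} (hT : NoShorterEndsNear w e A T) {R : G.Walk z q} (hR : IsShortestPath w R)
    (hq : ∀ q' ∈ A, gdist G w z q ≤ gdist G w z q') : ¬ HasDetour w e A (T.append R) := by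
  rintro ⟨z', hz', hz'x, hz'q, q', hq', hnear⟩
  have hz'R : z' ∈ R.support := by
    rcases (SimpleGraph.Walk.mem_support_append_iff T R).1 hz' with hz'T | hz'R
    · obtain ⟨T₁, T₂, rfl⟩ := SimpleGraph.Walk.mem_support_iff_exists_append.1 hz'T
      have hnear₁ := (hnear T₁ (T₂.append R) (T₁.append_assoc T₂ R).symm).1
      obtain rfl : z' = z := hT z' T₁ T₂ rfl ⟨hz'x, q', hq', hnear₁⟩
      exact R.start_mem_support
    · exact hz'R
  obtain ⟨R₁, R₂, rfl⟩ := SimpleGraph.Walk.mem_support_iff_exists_append.1 hz'R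
  refine (hq q' hq').not_gt ?_
  calc gdist G w z q' ≤ gdist G w z z' + gdist G w z' q' := gdist_triangle z z' q'
    _ ≤ len w R₁ + e * len w R₂ :=
        add_le_add (gdist_le_len R₁) (hnear (T.append R₁) R₂ (T.append_assoc R₁ R₂)).2
    _ < len w R₁ + len w R₂ := by
        exact_mod_cast add_lt_add_right (mul_lt_of_lt_one_left (len_pos hw R₂ hz'q) he) _
    _ = gdist G w z q := by rw [hR.gdist_eq, len_append, ENNReal.coe_add]

/-- The two bounds say, without a subtraction, that a hop of cost `(1 + e) a` makes a progress of
`(1 - e) a` towards `y`. -/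
lemma exists_hop [Finite V] (hw : ∀ e ∈ G.edgeSet, 0 < w e) (he : e < 1) {x y : V}
    (hr : ∀ q ∈ A, ∀ P : G.Walk x q, ¬ HasDetour w e A P → r q ≤ len w P)
    (hy : y ∈ A) (hxy : G.Reachable x y) (hne : x ≠ y) :
    ∃ q ∈ A, ∃ a b : ℝ≥0, 0 < a ∧ gdist G w x y = a + b ∧
      r q ≤ (1 + e) * a ∧ gdist G w q y ≤ e * a + b := by
  obtain ⟨P, hP⟩ := exists_shortest (w := w) hxy
  by_cases hdet : HasDetour w e A P
  · obtain ⟨z₀, T₀, B₀, rfl, hT₀⟩ := hdet.exists_endsNear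
    obtain ⟨z, T, B, rfl, ⟨hzx, q₀, hq₀, hzq₀⟩, hmin⟩ := hT₀.exists_noShorterEndsNear
    obtain ⟨q, hq, hqmin⟩ := Set.exists_min_image A (gdist G w z) (Set.toFinite A) ⟨q₀, hq₀⟩
    have hzq : gdist G w z q ≤ e * len w T := (hqmin q₀ hq₀).trans hzq₀
    obtain ⟨R, hR⟩ := exists_shortest (w := w) (gdist_lt_top.1
      (hzq.trans_lt (ENNReal.mul_lt_top ENNReal.coe_lt_top ENNReal.coe_lt_top)))
    refine ⟨q, hq, len w T, len w (B.append B₀), len_pos hw T hzx.symm, ?_, ?_, ?_⟩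
    · rw [hP.gdist_eq, ← SimpleGraph.Walk.append_assoc, len_append, ENNReal.coe_add]
    · calc r q ≤ len w (T.append R) := hr q hq _ (not_hasDetour_append hw he hmin hR hqmin)
        _ = len w T + gdist G w z q := by rw [len_append, ENNReal.coe_add, hR.gdist_eq]
        _ ≤ len w T + e * len w T := by gcongr
        _ = (1 + e) * len w T := by rw [one_add_mul]
    · calc gdist G w q y ≤ gdist G w q z + gdist G w z y := gdist_triangle q z y
        _ ≤ e * len w T + len w (B.append B₀) :=
            add_le_add (gdist_comm (G := G) q z ▸ hzq) (gdist_le_len _)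
  · refine ⟨y, hy, len w P, 0, len_pos hw P hne, by simp [hP.gdist_eq], ?_, by simp [gdist_self]⟩
    exact (hr y hy P hdet).trans (le_mul_of_one_le_left zero_le le_self_add)

end Detours

section AuxiliaryGraph

variable {V : Type*} {G : SimpleGraph V} {w : Sym2 V → ℝ≥0} {A : Set V} {wt : V → V → ℝ≥0∞}

lemma auxDist_self (a : A) : auxDist A wt a a = 0 :=
  le_antisymm ((iInf_le _ .nil).trans (by simp)) zero_le

lemma auxDist_le_add (a b c : A) : auxDist A wt a c ≤ wt a b + auxDist A wt b c := by
  rcases eq_or_ne a b with rfl | hab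
  · exact le_add_self
  · rw [auxDist, auxDist, ENNReal.add_iInf]
    exact le_iInf fun P => (iInf_le _ (P.cons hab)).trans (by simp)

lemma gdist_le_auxDist (h : ∀ x ∈ A, ∀ y ∈ A, gdist G w x y ≤ wt x y) (a b : A) :
    gdist G w a b ≤ auxDist A wt a b := by
  refine le_iInf fun P => ?_
  induction P with
  | nil => simp [gdist_self]
  | @cons a b c _ P ih =>
    rw [SimpleGraph.Walk.darts_cons, List.map_cons, List.sum_cons]
    exact (gdist_triangle _ _ _).trans (add_le_add (h a a.2 b b.2) ih)

/-- The hypothesis on `K` says that `K ≥ (1 + e) / (1 - e)`, without a subtraction. -/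
lemma auxDist_le_mul_gdist [Finite V] (hw : ∀ e ∈ G.edgeSet, 0 < w e) {e K : ℝ≥0}
    (hK : 1 + e + K * e ≤ K)
    (hwt : ∀ x ∈ A, ∀ y ∈ A, ∀ P : G.Walk x y, ¬ HasDetour w e A P → wt x y ≤ len w P)
    (x y : A) : auxDist A wt x y ≤ K * gdist G w x y := by
  have he : e < 1 := by
    by_contra! he
    have hKe : K ≤ K * e := le_mul_of_one_le_right zero_le he
    exact (lt_add_of_pos_left (K * e) (by positivity)).not_ge (hK.trans hKe)
  have wf : WellFounded (InvImage (· < ·) fun x : A => gdist G w x y) :=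
    Finite.wellFounded_of_trans_of_irrefl _
  induction x using wf.induction with
  | _ x ih =>
    rcases eq_or_ne x y with rfl | hne
    · exact (auxDist_self x).trans_le zero_le
    by_cases hxy : G.Reachable x y
    · obtain ⟨q, hq, a, b, ha, hab, hxq, hqy⟩ :=
        exists_hop hw he (hwt x x.2) y.2 hxy (Subtype.coe_ne_coe.2 hne)
      have hcloser : gdist G w q y < gdist G w x y := by
        refine hqy.trans_lt ?_
        rw [hab]
        exact_mod_cast add_lt_add_left (mul_lt_of_lt_one_left ha he) b
      calc auxDist A wt x y ≤ wt x q + auxDist A wt ⟨q, hq⟩ y := auxDist_le_add x ⟨q, hq⟩ y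
        _ ≤ (1 + e) * a + K * (e * a + b) :=
            add_le_add hxq ((ih ⟨q, hq⟩ hcloser).trans (by gcongr))
        _ = ((1 + e + K * e) * a + K * b : ℝ≥0) := by push_cast; ring
        _ ≤ (K * a + K * b : ℝ≥0) := by gcongr
        _ = K * gdist G w x y := by rw [hab]; push_cast; ring
    · rw [← gdist_lt_top (w := w), not_lt, top_le_iff] at hxy
      have hK0 : K ≠ 0 := by rintro rfl; simp at hK
      simp [hxy, ENNReal.mul_top, hK0]

end AuxiliaryGraph

namespace Choices

variable {V : Type*} [Fintype V] {G : SimpleGraph V} {w : Sym2 V → ℝ≥0}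

section Levels

variable (O : Choices G w) (d : ℕ) (c : ℝ) (D : Set V)

lemma exists_pathFrom_eq_cons (m : ℕ) (U : Set V) : ∃ l, O.pathFrom d c D m U = U :: l := by
  cases m with
  | zero => exact ⟨[], rfl⟩
  | succ m =>
    rw [pathFrom]
    split_ifs
    exacts [⟨_, rfl⟩, ⟨_, rfl⟩, ⟨_, rfl⟩]

lemma U_one : O.U d c D 1 = Set.univ := by
  obtain ⟨l, hl⟩ :=
    O.exists_pathFrom_eq_cons d c D ⌊1 / c * Real.logb d (Fintype.card V)⌋₊ Set.univ
  rw [U, hpath, hl]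
  rfl

variable {O d c D}

lemma le_length_hpath_of_mem_U {t : V} {i : ℕ} (h : t ∈ O.U d c D i) :
    i ≤ (O.hpath d c D).length := by
  by_contra! hi
  rw [U, List.getD_eq_default _ _ (by simpa using hi)] at h
  exact h

lemma bddAbove_setOf_mem_U (t : V) : BddAbove {i | t ∈ O.U d c D i} :=
  ⟨_, fun _ hi => le_length_hpath_of_mem_U hi⟩

lemma le_level {t : V} {i : ℕ} (h : t ∈ O.U d c D i) : i ≤ O.level d c D t :=
  le_csSup (bddAbove_setOf_mem_U t) h

lemma mem_U_one (t : V) : t ∈ O.U d c D 1 := U_one O d c D ▸ Set.mem_univ t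

lemma mem_U_level (t : V) : t ∈ O.U d c D (O.level d c D t) :=
  Nat.sSup_mem (s := {i | t ∈ O.U d c D i}) ⟨1, mem_U_one t⟩ (bddAbove_setOf_mem_U t)

end Levels

variable {O : Choices G w} {d : ℕ} {c : ℝ} {D : Set V}

section Neighbours

variable {H : SimpleGraph V}

lemma exists_mem_VH_gdist_le_of_forall_level_le (u v : V) (hH : H ≤ G) {g f : V}
    (Q : H.Walk g f) (hg : g ∉ D) (hf : f ∈ D)
    (hlevel : ∀ t ∈ Q.support, O.level d c D t ≤ O.level d c D g) :
    ∃ q ∈ O.VH d c D u v,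
      gdist (delVerts G D) w g q ≤ ENNReal.ofReal (2 * kParam V - 1) * len w Q := by
  set j := O.level d c D g
  have hQU : ∀ t ∈ Q.support, t ∉ O.U d c D (j + 1) :=
    fun t ht htU => (hlevel t ht).not_gt (le_level htU)
  obtain ⟨Q', hQ'⟩ := exists_walk_delVerts_len_eq (w := w) hH Q hQU
  obtain ⟨s, f', hf', q, hq, hqD, hle⟩ :=
    (O.cover (O.U d c D (j + 1)) (O.U d c D j)).exists_mem_nbrs_gdist_le (delVerts_le G _)
      ⟨mem_U_level g, hQU g Q.start_mem_support⟩ hg hf Q'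
  have hqN : q ∈ O.N d c D f' := ⟨j, le_level (mem_U_one g),
    le_length_hpath_of_mem_U (mem_U_level g), s, RootedTree.mem_verts_of_mem_nbrs hq, hq⟩
  exact ⟨q, ⟨Or.inr (Set.mem_iUnion₂.2 ⟨f', hf', hqN⟩), hqD⟩, hQ' ▸ hle⟩

/-- The tree cover is applied to the part of `Q` from a vertex of highest level before the first
failure to that failure. -/
lemma exists_mem_VH_gdist_le (hn : 3 ≤ Fintype.card V) (u v : V) (hH : H ≤ G) {z f : V}
    (Q : H.Walk z f) (hz : z ∉ D) (hf : f ∈ D)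
    (hlevel : ∀ t ∈ Q.support, t ∈ D → O.level d c D t ≤ O.level d c D z) :
    ∃ q ∈ O.VH d c D u v,
      gdist (delVerts G D) w z q ≤ ENNReal.ofReal (2 * kParam V - 1) * len w Q := by
  obtain ⟨p, f', P, h, B, rfl, hPD, hf'⟩ :=
    exists_eq_append_cons_of_mem_support Q hz hf Q.end_mem_support
  obtain ⟨g, hgP, hgmax⟩ := Set.exists_max_image {t | t ∈ P.support} (O.level d c D)
    (Set.toFinite _) ⟨z, P.start_mem_support⟩
  obtain ⟨P₁, P₂, rfl⟩ := SimpleGraph.Walk.mem_support_iff_exists_append.1 hgP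
  have hlevel' : ∀ t ∈ (P₂.concat h).support, O.level d c D t ≤ O.level d c D g := by
    intro t ht
    rw [SimpleGraph.Walk.support_concat, List.mem_append, List.mem_singleton] at ht
    rcases ht with ht | rfl
    · exact hgmax t ((SimpleGraph.Walk.mem_support_append_iff P₁ P₂).2 (Or.inr ht))
    · exact (hlevel t (by simp) hf').trans (hgmax z (SimpleGraph.Walk.start_mem_support _))
  obtain ⟨q, hq, hgq⟩ :=
    exists_mem_VH_gdist_le_of_forall_level_le u v hH (P₂.concat h) (hPD g hgP) hf' hlevel'
  have hzg : gdist (delVerts G D) w z g ≤ len w P₁ := gdist_delVerts_le_len hH P₁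
    fun t ht => hPD t ((SimpleGraph.Walk.mem_support_append_iff P₁ P₂).2 (Or.inl ht))
  have hlen : len w ((P₁.append P₂).append (B.cons h)) =
      len w P₁ + len w (P₂.concat h) + len w B := by
    rw [← SimpleGraph.Walk.append_assoc, ← SimpleGraph.Walk.concat_append, len_append, len_append,
      add_assoc]
  have hstretch : 1 ≤ ENNReal.ofReal (2 * kParam V - 1) :=
    ENNReal.one_le_ofReal.2 (one_le_two_mul_kParam_sub_one hn)
  refine ⟨q, hq, ?_⟩
  calc gdist (delVerts G D) w z q
      ≤ len w P₁ + ENNReal.ofReal (2 * kParam V - 1) * len w (P₂.concat h) :=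
        (gdist_triangle z g q).trans (add_le_add hzg hgq)
    _ ≤ ENNReal.ofReal (2 * kParam V - 1) * (len w P₁ + len w (P₂.concat h)) := by
        rw [mul_add]
        exact add_le_add_left (le_mul_of_one_le_left zero_le hstretch) _
    _ ≤ _ := by
        rw [hlen, ← ENNReal.coe_add]
        exact mul_le_mul' le_rfl (ENNReal.coe_le_coe.2 le_self_add)

end Neighbours

section DecisionTree

variable {ε : ℝ} {x y : V} {α β : Node V}

lemma gdist_le_storedLen (h : O.hit d c D x y α = ∅) :
    gdist (delVerts G D) w x y ≤ O.storedLen d c D x y α := by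
  rcases hP : O.path (O.avoid d c D α) x y with _ | P
  · simp only [storedLen, hP, le_top]
  · simp only [hit, storedLen, hP] at h ⊢
    exact gdist_delVerts_le_len (delVerts_le G _) P
      fun t ht htD => Set.eq_empty_iff_forall_notMem.1 h t ⟨htD, ht⟩

lemma storedLen_le_len (P : (delVerts G D).Walk x y)
    (hP : ∀ t ∈ P.support, t ∉ O.avoid d c D α) : O.storedLen d c D x y α ≤ len w P := by
  obtain ⟨Q, hQ⟩ := exists_walk_delVerts_len_eq (w := w) (delVerts_le G D) P hP
  rcases hα : O.path (O.avoid d c D α) x y with _ | P'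
  · exact absurd ⟨Q⟩ ((O.path_none _ x y).1 hα)
  · simp only [storedLen, hα]
    exact ENNReal.coe_le_coe.2 (((O.path_shortest _ x y P' hα).2 Q).trans_eq hQ)

variable [DecidableEq V]

/-- One round of the loop of `DecTree(x, y, D)`, from the node `α` to the node `β`, for some way of
breaking the ties between the failures of highest level. -/
def IsDescent (O : Choices G w) (d : ℕ) (c ε : ℝ) (D : Set V) (x y : V) (α β : Node V) : Prop :=
  ∃ f ∈ O.hit d c D x y α, (∀ g ∈ O.hit d c D x y α, O.level d c D g ≤ O.level d c D f) ∧
    β = O.descend d c ε D x y α f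

lemma IsDescent.exists_path (h : O.IsDescent d c ε D x y α β) :
    ∃ f ∈ D, ∃ P : (delVerts G (O.avoid d c D α)).Walk x y, IsShortestPath w P ∧ f ∈ P.support ∧
      (∀ g ∈ D, g ∈ P.support → O.level d c D g ≤ O.level d c D f) ∧
      O.avoid d c D β =
        O.avoid d c D α ∪ (seg w (eps2 V ε) f P ∩ O.U d c D (O.level d c D f)) := by
  obtain ⟨f, hf, hmax, rfl⟩ := h
  rcases hP : O.path (O.avoid d c D α) x y with _ | P
  · simp [hit, hP] at hf
  · simp only [hit, hP] at hf hmax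
    exact ⟨f, hf.1, P, O.path_shortest _ x y P hP, hf.2, fun g hgD hgP => hmax g ⟨hgD, hgP⟩,
      by simp only [descend, hP, avoid]⟩

lemma IsDescent.ncard_sdiff_avoid_lt (h : O.IsDescent d c ε D x y α β) (hx : x ∉ D) (hy : y ∉ D) :
    (D \ O.avoid d c D β).ncard < (D \ O.avoid d c D α).ncard := by
  obtain ⟨f, hf, P, -, hfP, -, hβ⟩ := h.exists_path
  have hfx : f ≠ x := ne_of_mem_of_not_mem hf hx
  have hfy : f ≠ y := ne_of_mem_of_not_mem hf hy
  rw [hβ]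
  refine Set.ncard_lt_ncard (Set.ssubset_iff_of_subset
    (Set.sdiff_subset_sdiff_right Set.subset_union_left) |>.2 ⟨f, ⟨hf, ?_⟩, ?_⟩)
  · exact notMem_of_mem_support_delVerts P hfP hfx
  · exact fun hfβ => hfβ.2 (Or.inr ⟨mem_seg_self P hfP hfx hfy, mem_U_level f⟩)

lemma IsDescent.hasDetour (h : O.IsDescent d c ε D x y α β) (hn : 3 ≤ Fintype.card V)
    (hw : ∀ e ∈ G.edgeSet, 0 < w e) (hε : 0 < ε) (hx : x ∉ D) (hy : y ∉ D) (u v : V)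
    {P : (delVerts G D).Walk x y} (hα : ∀ t ∈ P.support, t ∉ O.avoid d c D α) {z : V}
    (hz : z ∈ P.support) (hzβ : z ∈ O.avoid d c D β) :
    HasDetour w (ε / (2 + ε)).toNNReal (O.VH d c D u v) P := by
  obtain ⟨f, hf, Pα, hPα, hfPα, hmax, hβ⟩ := h.exists_path
  obtain ⟨hzseg, hzU⟩ := (hβ ▸ hzβ).resolve_left (hα z hz)
  have ⟨_, hzx, hzy, _⟩ := hzseg
  obtain ⟨Q, hQP, hQx, hQy⟩ := exists_walk_of_mem_seg (weight_pos_delVerts hw _) (eps2_pos hn hε)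
    hPα hfPα (ne_of_mem_of_not_mem hf hx) (ne_of_mem_of_not_mem hf hy) hzseg
  obtain ⟨q, hq, hzq⟩ := exists_mem_VH_gdist_le hn u v (delVerts_le G _) Q
    (notMem_of_mem_support_delVerts P hz hzx) hf
    fun t ht htD => (hmax t htD (hQP ht)).trans (le_level hzU)
  have hdetour : ∀ {a : ℝ≥0∞} {b : ℝ≥0}, len w Q ≤ ENNReal.ofReal (eps2 V ε) * a → a ≤ b →
      gdist (delVerts G D) w z q ≤ ENNReal.ofReal (ε / (2 + ε)) * b := fun {a b} ha hab => calc
    _ ≤ ENNReal.ofReal (2 * kParam V - 1) * (ENNReal.ofReal (eps2 V ε) * a) :=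
        hzq.trans (mul_le_mul' le_rfl ha)
    _ = ENNReal.ofReal (ε / (2 + ε)) * a := by rw [← mul_assoc, ofReal_mul_ofReal_eps2 hn]
    _ ≤ ENNReal.ofReal (ε / (2 + ε)) * b := by gcongr
  refine ⟨z, hz, hzx, hzy, q, hq, ?_⟩
  rintro P₁ P₂ rfl
  simp only [SimpleGraph.Walk.mem_support_append_iff] at hα
  exact ⟨hdetour hQx (gdist_delVerts_le_len (delVerts_le G D) P₁ fun t ht => hα t (Or.inl ht)),
    hdetour hQy (gdist_delVerts_le_len (delVerts_le G D) P₂ fun t ht => hα t (Or.inr ht))⟩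

lemma notMem_avoid_of_reflTransGen (hn : 3 ≤ Fintype.card V) (hw : ∀ e ∈ G.edgeSet, 0 < w e)
    (hε : 0 < ε) (hx : x ∉ D) (hy : y ∉ D) {u v : V} {P : (delVerts G D).Walk x y}
    (hP : ¬ HasDetour w (ε / (2 + ε)).toNNReal (O.VH d c D u v) P)
    (h : Relation.ReflTransGen (O.IsDescent d c ε D x y) [] α) :
    ∀ t ∈ P.support, t ∉ O.avoid d c D α := by
  induction h with
  | refl => exact fun t _ => Set.notMem_empty t
  | tail _ hstep ih =>
    exact fun t ht htβ => hP (hstep.hasDetour hn hw hε hx hy u v ih ht htβ)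

lemma isDescent_pick {pick : V → V → Node V → V} (hpick : O.IsPick d c D pick)
    (h : O.hit d c D x y α ≠ ∅) :
    O.IsDescent d c ε D x y α (O.descend d c ε D x y α (pick x y α)) :=
  have hmax := hpick x y α (Set.nonempty_iff_ne_empty.2 h)
  ⟨_, hmax.1, hmax.2, rfl⟩

lemma exists_decTreeLoop_eq {pick : V → V → Node V → V} (hpick : O.IsPick d c D pick) (hx : x ∉ D)
    (hy : y ∉ D) {m : ℕ} (hm : (D \ O.avoid d c D α).ncard ≤ m) :
    ∃ β, Relation.ReflTransGen (O.IsDescent d c ε D x y) α β ∧ O.hit d c D x y β = ∅ ∧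
      O.decTreeLoop d c ε D pick x y m α = some (O.storedLen d c D x y β) := by
  induction m generalizing α with
  | zero =>
    by_cases hα : O.hit d c D x y α = ∅
    · exact ⟨α, .refl, hα, by simp only [decTreeLoop, hα, if_true]⟩
    · have hlt := (isDescent_pick hpick (ε := ε) hα).ncard_sdiff_avoid_lt hx hy
      exact absurd (hlt.trans_le hm) (Nat.not_lt_zero _)
  | succ m ih =>
    by_cases hα : O.hit d c D x y α = ∅
    · exact ⟨α, .refl, hα, by simp only [decTreeLoop, hα, if_true]⟩
    · have hstep := isDescent_pick hpick (ε := ε) hα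
      obtain ⟨β, hβ, hhit, heq⟩ :=
        ih (Nat.le_of_lt_succ ((hstep.ncard_sdiff_avoid_lt hx hy).trans_le hm))
      exact ⟨β, hβ.head hstep, hhit, by rw [decTreeLoop, if_neg hα, heq]⟩

lemma exists_decTree_eq_some (hn : 3 ≤ Fintype.card V) (hw : ∀ e ∈ G.edgeSet, 0 < w e)
    (hε : 0 < ε) (hD : D.ncard ≤ d) {pick : V → V → Node V → V} (hpick : O.IsPick d c D pick)
    (u v : V) (hx : x ∉ D) (hy : y ∉ D) :
    ∃ r, O.decTree d c ε D pick x y = some r ∧ gdist (delVerts G D) w x y ≤ r ∧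
      ∀ P : (delVerts G D).Walk x y,
        ¬ HasDetour w (ε / (2 + ε)).toNNReal (O.VH d c D u v) P → r ≤ len w P := by
  obtain ⟨α, hα, hhit, heq⟩ := exists_decTreeLoop_eq (α := []) (ε := ε) hpick hx hy
    ((Set.ncard_le_ncard Set.sdiff_subset).trans hD)
  exact ⟨_, heq, gdist_le_storedLen hhit, fun P hP =>
    storedLen_le_len P (notMem_avoid_of_reflTransGen hn hw hε hx hy hP hα)⟩

end DecisionTree

end Choices

end VSDO

open VSDO in
theorem mainTheorem3_general {V : Type*} [Fintype V] [DecidableEq V]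
    (hn : 3 ≤ Fintype.card V)
    (G : SimpleGraph V) (w : Sym2 V → ℝ≥0) (hw : ∀ e ∈ G.edgeSet, 0 < w e)
    (d : ℕ) (c : ℝ) (ε : ℝ) (hε : 0 < ε)
    (O : Choices G w)
    (D : Set V) (hD : D.ncard ≤ d)
    (pick : V → V → Node V → V) (hpick : O.IsPick d c D pick)
    (u₀ v₀ : V) :
    ∃ wt : V → V → ℝ≥0∞,
      (∀ x ∈ O.VH d c D u₀ v₀, ∀ y ∈ O.VH d c D u₀ v₀,
        O.decTree d c ε D pick x y = some (wt x y)) ∧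
      ∀ u v : O.VH d c D u₀ v₀,
        gdist (delVerts G D) w u v ≤ auxDist (O.VH d c D u₀ v₀) wt u v ∧
        auxDist (O.VH d c D u₀ v₀) wt u v ≤
          ENNReal.ofReal (1 + ε) * gdist (delVerts G D) w u v := by
  have hdecTree (x y : V) (hx : x ∈ O.VH d c D u₀ v₀) (hy : y ∈ O.VH d c D u₀ v₀) :=
    Choices.exists_decTree_eq_some hn hw hε hD hpick u₀ v₀ hx.2 hy.2
  choose! wt hsome hge hle using hdecTree
  have hK : 1 + (ε / (2 + ε)).toNNReal + (1 + ε).toNNReal * (ε / (2 + ε)).toNNReal ≤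
      (1 + ε).toNNReal := by
    rw [← NNReal.coe_le_coe]
    push_cast
    rw [Real.coe_toNNReal _ (by positivity), Real.coe_toNNReal _ (by positivity)]
    refine le_of_eq ?_
    field_simp
    ring
  exact ⟨wt, fun x hx y hy => hsome x y hx hy, fun u v =>
    ⟨gdist_le_auxDist (fun x hx y hy => hge x y hx hy) u v,
      auxDist_le_mul_gdist (weight_pos_delVerts hw D) hK (fun x hx y hy => hle x y hx hy) u v⟩⟩

theorem mainTheorem3 {V : Type*} [Fintype V] [DecidableEq V]
    (hn : 3 ≤ Fintype.card V)
    (G : SimpleGraph V) (w : Sym2 V → ℝ≥0) (hw : ∀ e ∈ G.edgeSet, 0 < w e)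
    (d : ℕ) (hd : 2 ≤ d) (c : ℝ) (hc : 1 ≤ c) (ε : ℝ) (hε : 0 < ε)
    (O : VSDO.Choices G w)
    (D : Set V) (hD : D.ncard ≤ d)
    (pick : V → V → VSDO.Node V → V) (hpick : O.IsPick d c D pick)
    (u₀ v₀ : V) (hu₀ : u₀ ∉ D) (hv₀ : v₀ ∉ D) :
    ∃ wt : V → V → ℝ≥0∞,
      (∀ x ∈ O.VH d c D u₀ v₀, ∀ y ∈ O.VH d c D u₀ v₀,
        O.decTree d c ε D pick x y = some (wt x y)) ∧
      ∀ u v : O.VH d c D u₀ v₀,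
        VSDO.gdist (VSDO.delVerts G D) w u v ≤ VSDO.auxDist (O.VH d c D u₀ v₀) wt u v ∧
        VSDO.auxDist (O.VH d c D u₀ v₀) wt u v ≤
          ENNReal.ofReal (1 + ε) * VSDO.gdist (VSDO.delVerts G D) w u v :=
  mainTheorem3_general hn G w hw d c ε hε O D hD pick hpick u₀ v₀
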